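/- **Setting.** The state $S$ of a power system is a Markov chain driven by i.i.d. shocks $L$ (for instance the load): in state $S$ the shock $L$ leads to the next state $S^+_{SL}$ and to the spot price $P_{SL}$, where $\sup_S E_L|P_{SL}|<\infty$. Let $\delta\in[0,1)$ be the discount factor per dispatch interval, $E[P^+_{SL}]=E_{L'}[P_{S^+_{SL}L'}]$ the expected price of the next interval, and $x$ a stationary distribution of the chain. Put $$A(x)=E_{S\sim x}E_L\big[(\delta E[P^+_{SL}]-P_{SL})\,I(\delta E[P^+_{SL}]\ge P_{SL})\big],$$ the area below the discounted expected next-period price and above the price-duration curve, averaged over the states. A small price-taking storage facility that is not rate-limited and has capacity $K\ge 0$ chooses in each interval, knowing $S$, $L$ and its opening charge $s$, a closing charge $s^+\in[s^{min},s^{min}+K]$, and has the cashflow $P_{SL}(s-s^+)$. Its value $V(s|S,K)$ is the (bounded measurable) solution of the Bellman equation $$V(s|S,K)=\max_{s^+_{L}}E_L\big[P_{SL}(s-s^+_{L})+\delta V(s^+_{L}|S^+_{SL},K)\big].$$ Its fixed cost is $f_S$ per unit of capacity and dispatch interval. An investor who knows only the stationary distribution $x$ of the system state expects the net present value $N(K)=E_{S\sim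 x}[V(s|S,K)]-\frac{f_S}{1-\delta}K$. Augmenting the facility is *privately profitable* at $K$ if $N(K+h)>N(K)$ for all sufficiently small $h>0$. **Theorem B.** (1) For every $K\ge0$ the Bellman equation has exactly one solution. For all $s$ and $K\ge 0$, $\partial V/\partial K(s|S,K)$ exists for every $S$ (one-sided at $K=0$), its average over $S\sim x$ is $A(x)/(1-\delta)$, and $N'(K)=(A(x)-f_S)/(1-\delta)$. It is privately profitable to augment the facility if and only if $A(x)>f_S$. (2) Suppose that the state is the total state of charge $S\in[S^{min},S^{min}+K_S]$, $K_S\ge 0$, of the storage of a power system with i.i.d. bounded load $L$, dispatch intervals of length $\Delta>0$ and a convex differentiable dispatch cost rate $DC$ (the stock of generation being fixed); that $S^+_{SL}$ is a socially optimal rule, that is, a solution of the planner's Bellman equation $$W(S|K)=\min_{S^{min}\le S^+_{L}\le S^{min}+K}E_L\big[\Delta\, DC(L-(S-S^+_{L})/\Delta)+\delta W(S^+_{L}|K)\big]$$ for $K=K_S$; that $P_{SL}=DC'(L-(S-S^+_{SL})/\Delta)$; and that $x$ is stationary for this rule. Then $\partial W/\partial K(S|K_S)$ exists for every state of charge $S$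 (one-sided if $K_S=0$), its average over $x$ is $-A(x)/(1-\delta)$, and the expected total cost $C(K)=E_{S\sim x}[W(S|K)]+\frac{f_S}{1-\delta}K$ (with $x$ held fixed) has $C'(K_S)=-(A(x)-f_S)/(1-\delta)$. If $K_S>0$, then $K_S$ minimises $C$ over $K\ge0$ if and only if $A(x)=f_S$. Private and social incentives agree: it is privately profitable to augment a price-taking facility of any capacity $K\ge 0$ in this system if and only if it is socially beneficial to add storage to the system, i.e. $C(K_S+h)<C(K_S)$ for all sufficiently small $h>0$. -/

import Mathlib

open Set Filter Topology MeasureTheory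

/-- Data of a spot market whose state `S : 𝓢` evolves as a Markov chain driven by independent and
identically distributed shocks `L : 𝓛` (for instance the load) with law `load`: in state `S`, the
shock `L` leads to the spot price `price S L` and to the next state `next S L`.
`δ` is the discount factor per dispatch interval. -/
structure Market (𝓢 𝓛 : Type*) [MeasurableSpace 𝓢] [MeasurableSpace 𝓛] where
  load : Measure 𝓛
  next : 𝓢 → 𝓛 → 𝓢
  price : 𝓢 → 𝓛 → ℝ
  δ : ℝ

namespace Market

variable {𝓢 𝓛 : Type*} [MeasurableSpace 𝓢] [MeasurableSpace 𝓛]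

/-- Standing regularity: the shocks have a probability law, everything is measurable, the spot
price has an expected absolute value that is bounded over the states, and `0 ≤ δ < 1`. -/
structure Regular (M : Market 𝓢 𝓛) : Prop where
  prob : IsProbabilityMeasure M.load
  measurable_next : Measurable (fun p : 𝓢 × 𝓛 => M.next p.1 p.2)
  measurable_price : Measurable (fun p : 𝓢 × 𝓛 => M.price p.1 p.2)
  price_bound : ∃ C : ℝ, ∀ S, Integrable (M.price S) M.load ∧ ∫ L, |M.price S L| ∂M.load ≤ C
  δ_nonneg : 0 ≤ M.δ
  δ_lt_one : M.δ < 1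

/-- The law of the next state, given the current state `S`. -/
noncomputable def transition (M : Market 𝓢 𝓛) (S : 𝓢) : Measure 𝓢 := M.load.map (M.next S)

/-- `x` is a stationary distribution of the Markov chain of system states. -/
structure IsStationary (M : Market 𝓢 𝓛) (x : Measure 𝓢) : Prop where
  prob : IsProbabilityMeasure x
  invariant : ∀ A : Set 𝓢, MeasurableSet A → ∫⁻ S, M.transition S A ∂x = x A

/-- The expected spot price in state `S`, before the shock is realised. -/
noncomputable def meanPrice (M : Market 𝓢 𝓛) (S : 𝓢) : ℝ := ∫ L, M.price S L ∂M.load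

/-- In state `S`, the area below the discounted expected price of the next interval and above the
price-duration curve. -/
noncomputable def area (M : Market 𝓢 𝓛) (S : 𝓢) : ℝ :=
  ∫ L, max (M.δ * M.meanPrice (M.next S L) - M.price S L) 0 ∂M.load

/-- The average of that area over the distribution `x` of the states. -/
noncomputable def averageArea (M : Market 𝓢 𝓛) (x : Measure 𝓢) : ℝ := ∫ S, M.area S ∂x

/-- `V s S` is the value (present value of the stream of cashflows before fixed cost) of a small
price-taking storage facility with own opening charge `s`, in system state `S`, when the closing
charge can be freely chosen in `[smin, smin + K]`: the Bellman equation, over all strategies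
`L ↦ σ L`, with one-period cashflow `P (s - s⁺)`. Only closing charges are constrained; an opening
charge outside the range (as after a cut of the capacity) is brought into it within the interval. -/
structure IsPrivateValue (M : Market 𝓢 𝓛) (smin K : ℝ) (V : ℝ → 𝓢 → ℝ) : Prop where
  measurable : Measurable (fun p : ℝ × 𝓢 => V p.1 p.2)
  bounded : ∃ C : ℝ, ∀ s ∈ Icc smin (smin + K), ∀ S, |V s S| ≤ C
  bellman : ∀ s S, IsGreatest
    {r : ℝ | ∃ σ : 𝓛 → ℝ, Measurable σ ∧ (∀ L, σ L ∈ Icc smin (smin + K)) ∧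
      r = ∫ L, (M.price S L * (s - σ L) + M.δ * V (σ L) (M.next S L)) ∂M.load}
    (V s S)

/-- Expected net present value of a facility of capacity `K` and opening charge `s`, for an
investor who knows only the distribution `x` of the system state. `V K` is the value function for
capacity `K`, and `f` is the fixed cost per unit of capacity and interval. -/
noncomputable def netPresentValue (M : Market 𝓢 𝓛) (x : Measure 𝓢) (f : ℝ)
    (V : ℝ → ℝ → 𝓢 → ℝ) (s K : ℝ) : ℝ :=
  (∫ S, V K s S ∂x) - f / (1 - M.δ) * K

/-- It is profitable to augment a facility of capacity `K`: every sufficiently small addition of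
capacity strictly raises its expected net present value. -/
def ProfitableToAugment (M : Market 𝓢 𝓛) (x : Measure 𝓢) (f : ℝ)
    (V : ℝ → ℝ → 𝓢 → ℝ) (s K : ℝ) : Prop :=
  ∀ᶠ h in 𝓝[>] (0 : ℝ),
    M.netPresentValue x f V s K < M.netPresentValue x f V s (K + h)

end Market

/-- Data of a power system with storage and a given stock of generation: the law of the load, the
rate `DC` of the cost of dispatch as a function of the net demand, the length `Δ` of the dispatch
interval, the discount factor `δ` per interval, and the lowest state of charge `Smin`. -/
structure PowerSystem where
  load : Measure ℝ
  DC : ℝ → ℝ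
  Δ : ℝ
  δ : ℝ
  Smin : ℝ

namespace PowerSystem

/-- Standing assumptions: the load has a probability law on a bounded interval, the dispatch cost is
convex with a well-defined slope (the price), `0 < Δ` and `0 ≤ δ < 1`. -/
structure Regular (W : PowerSystem) : Prop where
  prob : IsProbabilityMeasure W.load
  bounded_load : ∃ Lmin Lmax : ℝ, ∀ᵐ L ∂W.load, L ∈ Icc Lmin Lmax
  convex_DC : ConvexOn ℝ univ W.DC
  differentiable_DC : Differentiable ℝ W.DC
  Δ_pos : 0 < W.Δ
  δ_nonneg : 0 ≤ W.δ
  δ_lt_one : W.δ < 1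

/-- The expected discounted cost when the opening charge is `S`, the closing charge is `σ L` and
the continuation cost is `V`. The cost of dispatch over one interval is `Δ * DC`. -/
noncomputable def expectedCost (W : PowerSystem) (V : ℝ → ℝ) (S : ℝ) (σ : ℝ → ℝ) : ℝ :=
  ∫ L, (W.Δ * W.DC (L - (S - σ L) / W.Δ) + W.δ * V (σ L)) ∂W.load

/-- `V S` is the least expected discounted cost of dispatch of the system with storage capacity `K`
and opening charge `S`: the Bellman equation of the planner. Only closing charges are
constrained. -/
structure IsSocialValue (W : PowerSystem) (K : ℝ) (V : ℝ → ℝ) : Prop where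
  measurable : Measurable V
  bounded : ∃ C : ℝ, ∀ S ∈ Icc W.Smin (W.Smin + K), |V S| ≤ C
  bellman : ∀ S, IsLeast
    {r : ℝ | ∃ σ : ℝ → ℝ, Measurable σ ∧ (∀ L, σ L ∈ Icc W.Smin (W.Smin + K)) ∧
      r = W.expectedCost V S σ}
    (V S)

/-- The set of states of charge of the system with storage capacity `K`. -/
abbrev Charge (W : PowerSystem) (K : ℝ) : Type := Icc W.Smin (W.Smin + K)

/-- The rule `R S L` for the closing charge is socially optimal: it solves the planner's Bellman
equation, with value function `V`, in every state of charge. -/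
structure IsOptimalRule (W : PowerSystem) (K : ℝ) (V : ℝ → ℝ)
    (R : W.Charge K → ℝ → W.Charge K) : Prop where
  measurable : Measurable (fun p : W.Charge K × ℝ => R p.1 p.2)
  optimal : ∀ S : W.Charge K, V S = W.expectedCost V S (fun L => (R S L : ℝ))

/-- The spot market of the power system when its storage follows the rule `R`: the system state is
the state of charge, the price is the slope of the dispatch cost at the net demand. -/
noncomputable def market (W : PowerSystem) (K : ℝ) (R : W.Charge K → ℝ → W.Charge K) :
    Market (W.Charge K) ℝ where
  load := W.load
  next := R
  price := fun S L => deriv W.DC (L - ((S : ℝ) - (R S L : ℝ)) / W.Δ)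
  δ := W.δ

/-- Expected total cost of the system with storage capacity `k`, for a planner who knows only the
distribution `x` of the state of charge (up to the fixed cost of the given stock of generation).
`V k` is the planner's value function for capacity `k`. -/
noncomputable def totalCost (W : PowerSystem) {K : ℝ} (x : Measure (W.Charge K)) (f : ℝ)
    (V : ℝ → ℝ → ℝ) (k : ℝ) : ℝ :=
  (∫ S : W.Charge K, V k S ∂x) + f / (1 - W.δ) * k

/-- It is socially beneficial to add storage to the system with storage capacity `K`: every
sufficiently small addition strictly lowers the expected total cost. -/
def BeneficialToAdd (W : PowerSystem) {K : ℝ} (x : Measure (W.Charge K)) (f : ℝ)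
    (V : ℝ → ℝ → ℝ) : Prop :=
  ∀ᶠ h in 𝓝[>] (0 : ℝ), W.totalCost x f V (K + h) < W.totalCost x f V K

end PowerSystem

/-! Private side: the Bellman integrand of a price taker is affine in the closing charge, with slope
the spread between the discounted expected next price and the current price. The best choice is
bang-bang and earns `K` times the positive part of the spread. So the value is explicit
(`privateValue`), affine in charge and capacity, and its slope in `K` is the discounted sum of
expected areas along the chain (`potential`). It is the only solution because an upper bound on the
difference of two solutions contracts by `δ`. Averaging the recursion for `potential` over a
stationary law gives `averageArea / (1 - δ)`.

Social side: the claim is that the planner's value has slope `-meanPrice` in the charge and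
`-potential` in the capacity (`tangent`). An optimal rule is bang-bang for the prices that it
generates itself, ties apart (`ae_full_or_empty`). With convexity of the dispatch cost, this
contracts any bound on how far a value lies below its tangent, so `tangent_le` holds globally.
Conversely, a strategy that shadows the rule, but fills to the new capacity when the price is low,
stays within `|k - K|` of it and loses only `ε * |k - K|` per interval (`exists_sub_tangent_le`).
The squeeze gives the derivative, and its uniformity in the state allows averaging. Both incentives
then reduce to the sign of `averageArea - f`. -/

/-! ### Analytic preliminaries -/

/-- If every upper bound `B` of a bounded set can be improved to `c + δ * B`, then `c / (1 - δ)` is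
an upper bound. -/
theorem le_div_one_sub_of_forall_upperBound {A : Set ℝ} {c δ : ℝ} (hA : BddAbove A) (hδ : δ < 1)
    (h : ∀ B : ℝ, (∀ r ∈ A, r ≤ B) → ∀ r ∈ A, r ≤ c + δ * B) : ∀ r ∈ A, r ≤ c / (1 - δ) := by
  intro r hr
  have h1 := h (sSup A) (fun r hr => le_csSup hA hr)
  have h2 : sSup A ≤ c + δ * sSup A := csSup_le ⟨r, hr⟩ h1
  have h3 : r ≤ sSup A := le_csSup hA hr
  rw [le_div_iff₀ (by linarith)]
  nlinarith

theorem MeasureTheory.abs_integral_le_of_abs_le {α : Type*} [MeasurableSpace α] {μ : Measure α}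
    [IsProbabilityMeasure μ] {g : α → ℝ} {C : ℝ} (hg : ∀ a, |g a| ≤ C) : |∫ a, g a ∂μ| ≤ C := by
  have := norm_integral_le_of_norm_le_const (μ := μ) (f := g) (C := C)
    (Eventually.of_forall hg)
  simpa using this

theorem MeasureTheory.integrable_of_measurable_of_abs_le {α : Type*} [MeasurableSpace α]
    {μ : Measure α} [IsFiniteMeasure μ] {g : α → ℝ} {C : ℝ} (hm : Measurable g)
    (hg : ∀ a, |g a| ≤ C) : Integrable g μ :=
  Integrable.of_bound hm.aestronglyMeasurable C (Eventually.of_forall hg)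

/-- A function on `[0, ∞)` with positive slope at `K` exceeds `g K` just to the right of `K`. -/
theorem HasDerivWithinAt.eventually_lt_add {g : ℝ → ℝ} {c K : ℝ} (hK : 0 ≤ K)
    (h : HasDerivWithinAt g c (Ici 0) K) (hc : 0 < c) : ∀ᶠ t in 𝓝[>] (0 : ℝ), g K < g (K + t) := by
  have h1 : HasDerivWithinAt g c (Ioi K) K :=
    h.mono (fun y hy => hK.trans (le_of_lt hy))
  have h2 := (hasDerivWithinAt_iff_tendsto_slope' (by simp)).1 h1
  have h3 : ∀ᶠ y in 𝓝[>] K, 0 < slope g K y := h2.eventually (lt_mem_nhds hc)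
  have h4 : Tendsto (fun t : ℝ => K + t) (𝓝[>] 0) (𝓝[>] K) := by
    refine tendsto_nhdsWithin_iff.2 ⟨?_, ?_⟩
    · have : Tendsto (fun t : ℝ => K + t) (𝓝 0) (𝓝 (K + 0)) := by
        exact (continuous_const.add continuous_id).tendsto 0
      rw [add_zero] at this
      exact this.mono_left nhdsWithin_le_nhds
    · filter_upwards [self_mem_nhdsWithin] with t ht
      simpa using ht
  filter_upwards [h4.eventually h3, self_mem_nhdsWithin] with t ht ht0
  have ht0' : (0 : ℝ) < t := ht0
  rw [slope_def_field, add_sub_cancel_left] at ht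
  have := (div_pos_iff_of_pos_right ht0').1 ht
  linarith

/-! ### The Markov chain and the discounted sum of areas -/

namespace Market

variable {𝓢 𝓛 : Type*} [MeasurableSpace 𝓢] [MeasurableSpace 𝓛] {M : Market 𝓢 𝓛}

/-- The expectation of a function of the next state, given the current state. -/
noncomputable def expectNext (M : Market 𝓢 𝓛) (g : 𝓢 → ℝ) (S : 𝓢) : ℝ :=
  ∫ L, g (M.next S L) ∂M.load

/-- The expected discounted sum of the areas along the chain started in `S`. -/
noncomputable def potential (M : Market 𝓢 𝓛) (S : 𝓢) : ℝ :=
  ∑' n : ℕ, M.δ ^ n * (M.expectNext^[n] M.area) S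

theorem Regular.measurable_next_apply (hM : M.Regular) (S : 𝓢) : Measurable (M.next S) :=
  hM.measurable_next.comp measurable_prodMk_left

theorem Regular.measurable_price_apply (hM : M.Regular) (S : 𝓢) : Measurable (M.price S) :=
  hM.measurable_price.comp measurable_prodMk_left

theorem Regular.measurable_integral (hM : M.Regular) {F : 𝓢 × 𝓛 → ℝ} (hF : Measurable F) :
    Measurable fun S => ∫ L, F (S, L) ∂M.load := by
  have := hM.prob
  exact hF.stronglyMeasurable.integral_prod_right'.measurable

theorem Regular.measurable_expectNext (hM : M.Regular) {g : 𝓢 → ℝ} (hg : Measurable g) :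
    Measurable (M.expectNext g) :=
  hM.measurable_integral (hg.comp hM.measurable_next)

theorem Regular.measurable_meanPrice (hM : M.Regular) : Measurable M.meanPrice :=
  hM.measurable_integral hM.measurable_price

theorem Regular.integrable_price (hM : M.Regular) (S : 𝓢) : Integrable (M.price S) M.load :=
  (hM.price_bound.choose_spec S).1

theorem Regular.exists_abs_meanPrice_le (hM : M.Regular) : ∃ C : ℝ, ∀ S, |M.meanPrice S| ≤ C := by
  obtain ⟨C, hC⟩ := hM.price_bound
  exact ⟨C, fun S => abs_integral_le_integral_abs.trans (hC S).2⟩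

theorem Regular.integrable_comp_next (hM : M.Regular) {g : 𝓢 → ℝ} (hg : Measurable g)
    (hb : ∃ C : ℝ, ∀ S, |g S| ≤ C) (S : 𝓢) : Integrable (fun L => g (M.next S L)) M.load := by
  have := hM.prob
  obtain ⟨C, hC⟩ := hb
  exact integrable_of_measurable_of_abs_le (hg.comp (hM.measurable_next_apply S)) (fun L => hC _)

theorem Regular.integrable_spread (hM : M.Regular) (S : 𝓢) :
    Integrable (fun L => M.δ * M.meanPrice (M.next S L) - M.price S L) M.load :=
  ((hM.integrable_comp_next hM.measurable_meanPrice hM.exists_abs_meanPrice_le S).const_mul _).sub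
    (hM.integrable_price S)

theorem Regular.integrable_max_spread (hM : M.Regular) (S : 𝓢) :
    Integrable (fun L => max (M.δ * M.meanPrice (M.next S L) - M.price S L) 0) M.load :=
  (hM.integrable_spread S).pos_part

theorem Regular.measurable_area (hM : M.Regular) : Measurable M.area :=
  hM.measurable_integral (F := fun q => max (M.δ * M.meanPrice (M.next q.1 q.2) - M.price q.1 q.2) 0)
    ((((hM.measurable_meanPrice.comp hM.measurable_next).const_mul _).sub
      hM.measurable_price).max measurable_const)

theorem Regular.exists_abs_area_le (hM : M.Regular) : ∃ C : ℝ, ∀ S, |M.area S| ≤ C := by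
  have := hM.prob
  obtain ⟨C, hC⟩ := hM.price_bound
  obtain ⟨B, hB⟩ := hM.exists_abs_meanPrice_le
  refine ⟨B + C, fun S => ?_⟩
  have h1 : |M.area S| ≤ ∫ L, |max (M.δ * M.meanPrice (M.next S L) - M.price S L) 0| ∂M.load :=
    abs_integral_le_integral_abs
  refine h1.trans ?_
  have h2 : ∫ L, |max (M.δ * M.meanPrice (M.next S L) - M.price S L) 0| ∂M.load ≤
      ∫ L, (B + |M.price S L|) ∂M.load := by
    refine integral_mono (hM.integrable_max_spread S).abs
      ((integrable_const _).add (hM.integrable_price S).abs) (fun L => ?_)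
    have h3 := hB (M.next S L)
    have h4 : |M.δ * M.meanPrice (M.next S L)| ≤ B := by
      rw [abs_mul, abs_of_nonneg hM.δ_nonneg]
      have := abs_nonneg (M.meanPrice (M.next S L))
      nlinarith [hM.δ_lt_one, hM.δ_nonneg]
    have h5 := abs_le.1 h4
    have h6 := neg_abs_le (M.price S L)
    have h7 := abs_nonneg (M.price S L)
    simp only
    rw [abs_of_nonneg (le_max_right _ _)]
    exact max_le (by linarith) (by linarith [h5.1])
  refine h2.trans ?_
  rw [integral_add (integrable_const _) (hM.integrable_price S).abs]
  have := (hC S).2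
  simp
  linarith

theorem Regular.measurable_iterate (hM : M.Regular) (n : ℕ) :
    Measurable (M.expectNext^[n] M.area) := by
  induction n with
  | zero => exact hM.measurable_area
  | succ n ih =>
    rw [Function.iterate_succ_apply']
    exact hM.measurable_expectNext ih

theorem Regular.abs_iterate_le (hM : M.Regular) {C : ℝ} (hC : ∀ S, |M.area S| ≤ C) (n : ℕ) (S : 𝓢) :
    |(M.expectNext^[n] M.area) S| ≤ C := by
  have := hM.prob
  induction n generalizing S with
  | zero => exact hC S
  | succ n ih =>
    rw [Function.iterate_succ_apply']
    exact abs_integral_le_of_abs_le (fun L => ih _)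

theorem Regular.abs_term_le (hM : M.Regular) {C : ℝ} (hC : ∀ S, |M.area S| ≤ C) (n : ℕ) (S : 𝓢) :
    ‖M.δ ^ n * (M.expectNext^[n] M.area) S‖ ≤ M.δ ^ n * C := by
  rw [Real.norm_eq_abs, abs_mul, abs_of_nonneg (pow_nonneg hM.δ_nonneg n)]
  exact mul_le_mul_of_nonneg_left (hM.abs_iterate_le hC n S) (pow_nonneg hM.δ_nonneg n)

theorem Regular.summable_geometric (hM : M.Regular) (C : ℝ) : Summable fun n : ℕ => M.δ ^ n * C :=
  (summable_geometric_of_lt_one hM.δ_nonneg hM.δ_lt_one).mul_right C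

theorem Regular.summable_term (hM : M.Regular) (S : 𝓢) :
    Summable fun n : ℕ => M.δ ^ n * (M.expectNext^[n] M.area) S := by
  obtain ⟨C, hC⟩ := hM.exists_abs_area_le
  exact Summable.of_norm_bounded (hM.summable_geometric C) (fun n => hM.abs_term_le hC n S)

theorem Regular.measurable_potential (hM : M.Regular) : Measurable M.potential := by
  refine measurable_of_tendsto_metrizable
    (f := fun N S => ∑ n ∈ Finset.range N, M.δ ^ n * (M.expectNext^[n] M.area) S) (fun N => ?_) ?_
  · exact Finset.measurable_sum _ (fun n _ => (hM.measurable_iterate n).const_mul _)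
  · exact tendsto_pi_nhds.2 (fun S => (hM.summable_term S).hasSum.tendsto_sum_nat)

theorem Regular.exists_abs_potential_le (hM : M.Regular) : ∃ C : ℝ, ∀ S, |M.potential S| ≤ C := by
  obtain ⟨C, hC⟩ := hM.exists_abs_area_le
  exact ⟨∑' n : ℕ, M.δ ^ n * C, fun S =>
    tsum_of_norm_bounded (hM.summable_geometric C).hasSum (fun n => hM.abs_term_le hC n S)⟩

/-- Split off the term `n = 0`. The remaining series is the expectation of the series started at the
next state, by dominated convergence with a geometric majorant. -/
theorem Regular.potential_eq (hM : M.Regular) (S : 𝓢) :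
    M.potential S = M.area S + M.δ * M.expectNext M.potential S := by
  have := hM.prob
  obtain ⟨C, hC⟩ := hM.exists_abs_area_le
  have h1 : HasSum (fun n : ℕ => ∫ L, M.δ ^ n * (M.expectNext^[n] M.area) (M.next S L) ∂M.load)
      (∫ L, M.potential (M.next S L) ∂M.load) := by
    refine hasSum_integral_of_dominated_convergence (fun n _ => M.δ ^ n * C) (fun n => ?_)
      (fun n => Eventually.of_forall fun L => hM.abs_term_le hC n _)
      (Eventually.of_forall fun L => hM.summable_geometric C) (integrable_const _)
      (Eventually.of_forall fun L => (hM.summable_term _).hasSum)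
    exact (((hM.measurable_iterate n).comp
      (hM.measurable_next_apply S)).const_mul _).aestronglyMeasurable
  have h2 : M.potential S = _ := (hM.summable_term S).tsum_eq_zero_add
  rw [h2, expectNext, ← h1.tsum_eq, ← tsum_mul_left]
  simp only [pow_zero, one_mul, Function.iterate_zero, id_eq]
  congr 1
  refine tsum_congr fun n => ?_
  rw [integral_const_mul, Function.iterate_succ_apply', pow_succ']
  simp only [expectNext, mul_assoc]

/-- Stationarity says that `next` pushes the product of `x` and the shock law forward to `x`; the
rest is change of variables and Fubini. -/
theorem Regular.integral_expectNext (hM : M.Regular) {x : Measure 𝓢} (hx : M.IsStationary x)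
    {g : 𝓢 → ℝ} (hg : Measurable g) (hb : ∃ C : ℝ, ∀ S, |g S| ≤ C) :
    ∫ S, M.expectNext g S ∂x = ∫ S, g S ∂x := by
  have := hM.prob
  have := hx.prob
  have h1 : (x.prod M.load).map (fun q => M.next q.1 q.2) = x := by
    ext A hA
    rw [Measure.map_apply hM.measurable_next hA,
      Measure.prod_apply (hM.measurable_next hA), ← hx.invariant A hA]
    refine lintegral_congr fun S => ?_
    rw [transition, Measure.map_apply (hM.measurable_next_apply S) hA]
    rfl
  obtain ⟨C, hC⟩ := hb
  have h2 : Integrable (fun q : 𝓢 × 𝓛 => g (M.next q.1 q.2)) (x.prod M.load) :=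
    integrable_of_measurable_of_abs_le (hg.comp hM.measurable_next) (fun q => hC _)
  conv_rhs => rw [← h1]
  rw [integral_map hM.measurable_next.aemeasurable hg.aestronglyMeasurable, integral_prod _ h2]
  rfl

theorem Regular.integrable_potential (hM : M.Regular) {x : Measure 𝓢} (hx : M.IsStationary x) :
    Integrable M.potential x := by
  have := hx.prob
  obtain ⟨C, hC⟩ := hM.exists_abs_potential_le
  exact integrable_of_measurable_of_abs_le hM.measurable_potential hC

theorem Regular.integrable_meanPrice (hM : M.Regular) {x : Measure 𝓢} (hx : M.IsStationary x) :
    Integrable M.meanPrice x := by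
  have := hx.prob
  obtain ⟨C, hC⟩ := hM.exists_abs_meanPrice_le
  exact integrable_of_measurable_of_abs_le hM.measurable_meanPrice hC

theorem Regular.integral_potential (hM : M.Regular) {x : Measure 𝓢} (hx : M.IsStationary x) :
    ∫ S, M.potential S ∂x = M.averageArea x / (1 - M.δ) := by
  have := hM.prob
  have := hx.prob
  obtain ⟨C, hC⟩ := hM.exists_abs_potential_le
  obtain ⟨C', hC'⟩ := hM.exists_abs_area_le
  have h1 : ∫ S, M.potential S ∂x = M.averageArea x + M.δ * ∫ S, M.potential S ∂x := by
    conv_lhs => rw [show M.potential = fun S => M.area S + M.δ * M.expectNext M.potential S from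
      funext hM.potential_eq]
    rw [integral_add (integrable_of_measurable_of_abs_le hM.measurable_area hC')
      ((integrable_of_measurable_of_abs_le (hM.measurable_expectNext hM.measurable_potential)
        (fun S => abs_integral_le_of_abs_le fun L => hC _)).const_mul _), integral_const_mul,
      hM.integral_expectNext hx hM.measurable_potential ⟨C, hC⟩]
    rfl
  have := hM.δ_lt_one
  rw [eq_div_iff (by linarith)]
  linarith

/-! ### The private Bellman equation -/

/-- The value of a price-taking facility, in closed form. -/
noncomputable def privateValue (M : Market 𝓢 𝓛) (smin K s : ℝ) (S : 𝓢) : ℝ :=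
  M.meanPrice S * (s - smin) + K * M.potential S

theorem Regular.measurable_privateValue (hM : M.Regular) (smin K : ℝ) :
    Measurable (fun q : ℝ × 𝓢 => M.privateValue smin K q.1 q.2) :=
  ((hM.measurable_meanPrice.comp measurable_snd).mul (measurable_fst.sub_const smin)).add
    ((hM.measurable_potential.comp measurable_snd).const_mul K)

theorem Regular.exists_abs_privateValue_le (hM : M.Regular) (smin K : ℝ) :
    ∃ C : ℝ, ∀ s ∈ Icc smin (smin + K), ∀ S, |M.privateValue smin K s S| ≤ C := by
  obtain ⟨B, hB⟩ := hM.exists_abs_meanPrice_le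
  obtain ⟨C, hC⟩ := hM.exists_abs_potential_le
  refine ⟨B * |K| + |K| * C, fun s hs S => (abs_add_le _ _).trans ?_⟩
  rw [abs_mul, abs_mul]
  have h1 : |s - smin| ≤ |K| := by
    rw [abs_of_nonneg (by linarith [hs.1])]
    exact le_trans (by linarith [hs.2]) (le_abs_self K)
  exact add_le_add (mul_le_mul (hB S) h1 (abs_nonneg _) ((abs_nonneg _).trans (hB S)))
    (mul_le_mul_of_nonneg_left (hC S) (abs_nonneg _))

/-- The cashflows of a strategy have an expectation. -/
theorem Regular.integrable_cashflow (hM : M.Regular) {smin K : ℝ} {V : ℝ → 𝓢 → ℝ}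
    (hV : Measurable (fun q : ℝ × 𝓢 => V q.1 q.2))
    (hb : ∃ C : ℝ, ∀ s ∈ Icc smin (smin + K), ∀ S, |V s S| ≤ C) {σ : 𝓛 → ℝ} (hσ : Measurable σ)
    (hmem : ∀ L, σ L ∈ Icc smin (smin + K)) (s : ℝ) (S : 𝓢) :
    Integrable (fun L => M.price S L * (s - σ L) + M.δ * V (σ L) (M.next S L)) M.load := by
  have := hM.prob
  obtain ⟨C, hC⟩ := hb
  refine Integrable.add ?_ (Integrable.const_mul ?_ _)
  · refine (hM.integrable_price S).mul_bdd (c := |s - smin| + |K|)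
      (measurable_const.sub hσ).aestronglyMeasurable (Eventually.of_forall fun L => ?_)
    rw [Real.norm_eq_abs, show s - σ L = (s - smin) - (σ L - smin) by ring]
    refine (abs_sub _ _).trans (add_le_add le_rfl ?_)
    rw [abs_of_nonneg (by linarith [(hmem L).1])]
    exact le_trans (by linarith [(hmem L).2]) (le_abs_self K)
  · exact integrable_of_measurable_of_abs_le (hV.comp (hσ.prodMk (hM.measurable_next_apply S)))
      (fun L => hC _ (hmem L) _)

/-- The integrand is the pointwise optimum over closing charges, so the Bellman equation can be
checked shock by shock. -/
theorem Regular.privateValue_eq_integral (hM : M.Regular) (smin K s : ℝ) (S : 𝓢) :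
    M.privateValue smin K s S = ∫ L, (M.price S L * (s - smin) +
      K * max (M.δ * M.meanPrice (M.next S L) - M.price S L) 0 +
      M.δ * K * M.potential (M.next S L)) ∂M.load := by
  have i1 := (hM.integrable_price S).mul_const (s - smin)
  have i2 := (hM.integrable_max_spread S).const_mul K
  have i3 := (hM.integrable_comp_next hM.measurable_potential hM.exists_abs_potential_le S).const_mul
    (M.δ * K)
  have i12 : Integrable (fun L => M.price S L * (s - smin) +
      K * max (M.δ * M.meanPrice (M.next S L) - M.price S L) 0) M.load := i1.add i2
  rw [integral_add i12 i3, integral_add i1 i2, integral_mul_const, integral_const_mul,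
    integral_const_mul, privateValue, hM.potential_eq S]
  simp only [meanPrice, area, expectNext]
  ring

theorem Regular.isPrivateValue_privateValue (hM : M.Regular) {smin K : ℝ} (hK : 0 ≤ K) :
    M.IsPrivateValue smin K (M.privateValue smin K) where
  measurable := hM.measurable_privateValue smin K
  bounded := hM.exists_abs_privateValue_le smin K
  bellman s S := by
    classical
    constructor
    -- The bang-bang strategy: full when the spread is nonnegative, empty otherwise.
    · refine ⟨fun L => if M.price S L ≤ M.δ * M.meanPrice (M.next S L) then smin + K else smin,
        ?_, fun L => ?_, ?_⟩
      · exact Measurable.ite (measurableSet_le (hM.measurable_price_apply S)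
          ((hM.measurable_meanPrice.comp (hM.measurable_next_apply S)).const_mul _))
          measurable_const measurable_const
      · dsimp only
        split_ifs
        · exact ⟨by linarith, le_rfl⟩
        · exact ⟨le_rfl, by linarith⟩
      · rw [hM.privateValue_eq_integral]
        refine integral_congr_ae (Eventually.of_forall fun L => ?_)
        simp only [privateValue]
        split_ifs with h
        · rw [max_eq_left (by linarith)]; ring
        · rw [max_eq_right (by linarith)]; ring
    · rintro r ⟨σ, hσ, hmem, rfl⟩
      rw [hM.privateValue_eq_integral]
      refine integral_mono (hM.integrable_cashflow (hM.measurable_privateValue smin K)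
        (hM.exists_abs_privateValue_le smin K) hσ hmem s S) ?_ (fun L => ?_)
      · exact (((hM.integrable_price S).mul_const (s - smin)).add
          ((hM.integrable_max_spread S).const_mul K)).add
          ((hM.integrable_comp_next hM.measurable_potential hM.exists_abs_potential_le S).const_mul
            (M.δ * K))
      · simp only [privateValue]
        have h1 := (hmem L).1
        have h2 := (hmem L).2
        have h3 := le_max_left (M.δ * M.meanPrice (M.next S L) - M.price S L) 0
        have h4 := le_max_right (M.δ * M.meanPrice (M.next S L) - M.price S L) 0
        -- Spread times `σ L - smin` is at most its positive part times `σ L - smin`, hence at most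
        -- `K` times the positive part.
        nlinarith [mul_le_mul_of_nonneg_right h3 (sub_nonneg.2 h1),
          mul_le_mul_of_nonneg_left (show σ L - smin ≤ K by linarith) h4]

/-- A strategy optimal for `V` is feasible for `V'`; the cashflows cancel and only the discounted
continuation gap remains. The conclusion covers opening charges outside the range, since only
closing charges are constrained. -/
theorem IsPrivateValue.sub_le (hM : M.Regular) {smin K B : ℝ} {V V' : ℝ → 𝓢 → ℝ}
    (hV : M.IsPrivateValue smin K V) (hV' : M.IsPrivateValue smin K V')
    (hB : ∀ s ∈ Icc smin (smin + K), ∀ S, V s S - V' s S ≤ B) (s : ℝ) (S : 𝓢) :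
    V s S - V' s S ≤ M.δ * B := by
  have := hM.prob
  obtain ⟨σ, hσ, hmem, h⟩ := (hV.bellman s S).1
  have h' := (hV'.bellman s S).2 ⟨σ, hσ, hmem, rfl⟩
  have i := hM.integrable_cashflow hV.measurable hV.bounded hσ hmem s S
  have i' := hM.integrable_cashflow hV'.measurable hV'.bounded hσ hmem s S
  have h1 : V s S ≤ ∫ L, ((M.price S L * (s - σ L) + M.δ * V' (σ L) (M.next S L)) + M.δ * B)
      ∂M.load := by
    rw [h]
    refine integral_mono i (i'.add (integrable_const _)) (fun L => ?_)
    have := mul_le_mul_of_nonneg_left (hB _ (hmem L) (M.next S L)) hM.δ_nonneg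
    dsimp only
    linarith
  rw [integral_add i' (integrable_const _)] at h1
  simp at h1
  linarith

theorem IsPrivateValue.le (hM : M.Regular) {smin K : ℝ} {V V' : ℝ → 𝓢 → ℝ}
    (hV : M.IsPrivateValue smin K V) (hV' : M.IsPrivateValue smin K V') (s : ℝ) (S : 𝓢) :
    V s S ≤ V' s S := by
  obtain ⟨C, hC⟩ := hV.bounded
  obtain ⟨C', hC'⟩ := hV'.bounded
  have key := le_div_one_sub_of_forall_upperBound (c := 0) (δ := M.δ)
    (A := {r | ∃ s ∈ Icc smin (smin + K), ∃ S, r = V s S - V' s S}) ?_ hM.δ_lt_one ?_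
  · rw [zero_div] at key
    have := hV.sub_le hM hV' (B := 0) (fun s hs S => key _ ⟨s, hs, S, rfl⟩) s S
    linarith
  · refine ⟨C + C', ?_⟩
    rintro r ⟨s, hs, S, rfl⟩
    have h1 := abs_le.1 (hC s hs S)
    have h2 := abs_le.1 (hC' s hs S)
    linarith [h1.2, h2.1]
  · rintro B hB r ⟨s, hs, S, rfl⟩
    rw [zero_add]
    exact hV.sub_le hM hV' (fun s hs S => hB _ ⟨s, hs, S, rfl⟩) s S

theorem IsPrivateValue.eq_privateValue (hM : M.Regular) {smin K : ℝ} (hK : 0 ≤ K)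
    {V : ℝ → 𝓢 → ℝ} (hV : M.IsPrivateValue smin K V) : V = M.privateValue smin K := by
  funext s S
  exact le_antisymm (hV.le hM (hM.isPrivateValue_privateValue hK) s S)
    ((hM.isPrivateValue_privateValue hK).le hM hV s S)

/-! ### Net present value and private incentives -/

theorem Regular.netPresentValue_eq (hM : M.Regular) {x : Measure 𝓢} (hx : M.IsStationary x)
    {smin f : ℝ} {V : ℝ → ℝ → 𝓢 → ℝ} (hV : ∀ K : ℝ, 0 ≤ K → M.IsPrivateValue smin K (V K))
    (s : ℝ) {K : ℝ} (hK : 0 ≤ K) :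
    M.netPresentValue x f V s K =
      (∫ S, M.meanPrice S ∂x) * (s - smin) + (M.averageArea x - f) / (1 - M.δ) * K := by
  rw [netPresentValue, (hV K hK).eq_privateValue hM hK]
  simp only [privateValue]
  rw [integral_add ((hM.integrable_meanPrice hx).mul_const _)
    ((hM.integrable_potential hx).const_mul _), integral_mul_const, integral_const_mul,
    hM.integral_potential hx]
  ring

theorem Regular.hasDerivWithinAt_netPresentValue (hM : M.Regular) {x : Measure 𝓢}
    (hx : M.IsStationary x) {smin f : ℝ} {V : ℝ → ℝ → 𝓢 → ℝ}
    (hV : ∀ K : ℝ, 0 ≤ K → M.IsPrivateValue smin K (V K)) (s : ℝ) {K : ℝ} (hK : 0 ≤ K) :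
    HasDerivWithinAt (fun k => M.netPresentValue x f V s k)
      ((M.averageArea x - f) / (1 - M.δ)) (Ici 0) K := by
  have h1 : HasDerivWithinAt (fun k => (∫ S, M.meanPrice S ∂x) * (s - smin) +
      (M.averageArea x - f) / (1 - M.δ) * k) ((M.averageArea x - f) / (1 - M.δ)) (Ici 0) K := by
    have h := (((hasDerivAt_id K).const_mul ((M.averageArea x - f) / (1 - M.δ))).const_add
      ((∫ S, M.meanPrice S ∂x) * (s - smin))).hasDerivWithinAt (s := Ici 0)
    simpa using h
  exact h1.congr (fun k hk => hM.netPresentValue_eq hx hV s hk) (hM.netPresentValue_eq hx hV s hK)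

theorem Regular.profitableToAugment_iff (hM : M.Regular) {x : Measure 𝓢}
    (hx : M.IsStationary x) {smin f : ℝ} {V : ℝ → ℝ → 𝓢 → ℝ}
    (hV : ∀ K : ℝ, 0 ≤ K → M.IsPrivateValue smin K (V K)) (s : ℝ) {K : ℝ} (hK : 0 ≤ K) :
    M.ProfitableToAugment x f V s K ↔ f < M.averageArea x := by
  have hδ : 0 < 1 - M.δ := sub_pos.2 hM.δ_lt_one
  constructor
  · intro h
    obtain ⟨t, ht, ht0⟩ := (h.and self_mem_nhdsWithin).exists
    have ht0 : (0 : ℝ) < t := ht0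
    rw [hM.netPresentValue_eq hx hV s hK, hM.netPresentValue_eq hx hV s (by linarith)] at ht
    have h1 : 0 < (M.averageArea x - f) / (1 - M.δ) * t := by linarith
    have h2 := (div_pos_iff_of_pos_right hδ).1 (pos_of_mul_pos_left h1 ht0.le)
    linarith
  · intro h
    exact (hM.hasDerivWithinAt_netPresentValue hx hV s hK).eventually_lt_add hK
      (div_pos (by linarith) hδ)

theorem Regular.exists_hasDerivWithinAt_privateValue (hM : M.Regular) {x : Measure 𝓢}
    (hx : M.IsStationary x) {smin : ℝ} {V : ℝ → ℝ → 𝓢 → ℝ}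
    (hV : ∀ K : ℝ, 0 ≤ K → M.IsPrivateValue smin K (V K)) (s : ℝ) {K : ℝ} (hK : 0 ≤ K) :
    ∃ v : 𝓢 → ℝ, (∀ S, HasDerivWithinAt (fun k => V k s S) (v S) (Ici 0) K) ∧
      Integrable v x ∧ ∫ S, v S ∂x = M.averageArea x / (1 - M.δ) := by
  refine ⟨M.potential, fun S => ?_, hM.integrable_potential hx, hM.integral_potential hx⟩
  have h1 : HasDerivWithinAt (fun k => M.privateValue smin k s S) (M.potential S) (Ici 0) K := by
    have h := (((hasDerivAt_id K).mul_const (M.potential S)).const_add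
      (M.meanPrice S * (s - smin))).hasDerivWithinAt (s := Ici 0)
    simpa [privateValue] using h
  exact h1.congr (fun k hk => by rw [(hV k hk).eq_privateValue hM hk])
    (by rw [(hV K hK).eq_privateValue hM hK])

end Market

/-! ### Differentiable convex functions on the line -/

theorem ConvexOn.deriv_mul_add_le {g : ℝ → ℝ} (hg : ConvexOn ℝ univ g) (hd : Differentiable ℝ g)
    (y z : ℝ) : g y + deriv g y * (z - y) ≤ g z := by
  rcases lt_trichotomy y z with h | h | h
  · have h1 := hg.le_slope_of_hasDerivAt (mem_univ y) (mem_univ z) h (hd y).hasDerivAt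
    rw [slope_def_field, le_div_iff₀ (by linarith)] at h1
    linarith
  · simp [h]
  · have h1 := hg.slope_le_of_hasDerivAt (mem_univ z) (mem_univ y) h (hd y).hasDerivAt
    rw [slope_def_field, div_le_iff₀ (by linarith)] at h1
    linarith

/-- The derivative is monotone and, by Darboux, takes all intermediate values, so it cannot jump. -/
theorem ConvexOn.continuous_deriv {g : ℝ → ℝ} (hg : ConvexOn ℝ univ g) (hd : Differentiable ℝ g) :
    Continuous (deriv g) := by
  have hm : Monotone (deriv g) := fun x y hxy =>
    hg.monotoneOn_deriv (fun x _ => hd x) (mem_univ x) (mem_univ y) hxy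
  have hdar : ∀ {a b m : ℝ}, a < b → deriv g a < m → m < deriv g b →
      ∃ c ∈ Ioo a b, deriv g c = m := fun hab ha hb =>
    exists_hasDerivWithinAt_eq_of_gt_of_lt hab.le
      (fun x _ => (hd x).hasDerivAt.hasDerivWithinAt) ha hb
  refine continuous_iff_continuousAt.2 fun a => tendsto_order.2 ⟨fun m hma => ?_, fun m hma => ?_⟩
  · rcases lt_or_ge m (deriv g (a - 1)) with h | h
    · filter_upwards [lt_mem_nhds (show a - 1 < a by linarith)] with y hy
      exact h.trans_le (hm (le_of_lt hy))
    · obtain ⟨m', h1, h2⟩ := exists_between hma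
      obtain ⟨c, hc, hcm⟩ := hdar (show a - 1 < a by linarith) (h.trans_lt h1) h2
      filter_upwards [lt_mem_nhds hc.2] with y hy
      exact (h1.trans_eq hcm.symm).trans_le (hm (le_of_lt hy))
  · rcases lt_or_ge (deriv g (a + 1)) m with h | h
    · filter_upwards [gt_mem_nhds (show a < a + 1 by linarith)] with y hy
      exact (hm (le_of_lt hy)).trans_lt h
    · obtain ⟨m', h1, h2⟩ := exists_between hma
      obtain ⟨c, hc, hcm⟩ := hdar (show a < a + 1 by linarith) h1 (h2.trans_le h)
      filter_upwards [gt_mem_nhds hc.1] with y hy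
      exact (hm (le_of_lt hy)).trans_lt (hcm.trans_lt h2)

/-- On compact intervals, the first-order expansion of a differentiable convex function is
uniform. -/
theorem ConvexOn.exists_le_deriv_mul_add {g : ℝ → ℝ} (hg : ConvexOn ℝ univ g)
    (hd : Differentiable ℝ g) (a b : ℝ) {ε : ℝ} (hε : 0 < ε) :
    ∃ η > 0, ∀ y ∈ Icc a b, ∀ t : ℝ, |t| ≤ η → g (y + t) ≤ g y + deriv g y * t + ε * |t| := by
  have huc := isCompact_Icc.uniformContinuousOn_of_continuous
    (s := Icc (a - 1) (b + 1))
    (hg.continuous_deriv hd).continuousOn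
  obtain ⟨η, hη, h⟩ := Metric.uniformContinuousOn_iff.1 huc ε hε
  -- The `1` keeps `y + t` in the enlarged interval; the half turns `≤` into the strict bound needed
  -- for uniform continuity.
  refine ⟨min 1 (η / 2), by positivity, fun y hy t ht => ?_⟩
  have ht1 := abs_le.1 (ht.trans (min_le_left _ _))
  have ht2 := ht.trans (min_le_right _ _)
  have h1 := h (y + t) ⟨by linarith [hy.1], by linarith [hy.2]⟩ y
    ⟨by linarith [hy.1], by linarith [hy.2]⟩ (by
      rw [Real.dist_eq, add_sub_cancel_left]; linarith)
  rw [Real.dist_eq] at h1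
  -- The tangent at `y + t`, read at `y`, bounds `g (y + t)` from above with slope `deriv g (y +
  -- t)`.
  have h2 := hg.deriv_mul_add_le hd (y + t) y
  have h3 : (deriv g (y + t) - deriv g y) * t ≤ ε * |t| :=
    (le_abs_self _).trans (by
      rw [abs_mul]; exact mul_le_mul_of_nonneg_right h1.le (abs_nonneg t))
  linarith

theorem MeasureTheory.ae_eq_zero_of_nonpos_of_integral_nonneg {α : Type*} [MeasurableSpace α]
    {μ : Measure α} {g : α → ℝ} (hi : Integrable g μ) (h0 : ∀ a, g a ≤ 0)
    (h : 0 ≤ ∫ a, g a ∂μ) : ∀ᵐ a ∂μ, g a = 0 := by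
  have h1 : ∫ a, -g a ∂μ = 0 :=
    le_antisymm (by rw [integral_neg]; linarith)
      (integral_nonneg fun a => neg_nonneg.2 (h0 a))
  have h2 := (integral_eq_zero_iff_of_nonneg (fun a => neg_nonneg.2 (h0 a)) hi.neg).1 h1
  filter_upwards [h2] with a ha
  simpa using ha

/-- A function is differentiable where it is squeezed between its tangent and a small cone. -/
theorem hasDerivWithinAt_of_le_of_le {g : ℝ → ℝ} {s : Set ℝ} {c K : ℝ}
    (hlow : ∀ k ∈ s, g K + (k - K) * c ≤ g k)
    (hup : ∀ ε > 0, ∃ η > 0, ∀ k ∈ s, |k - K| ≤ η → g k ≤ g K + (k - K) * c + ε * |k - K|) :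
    HasDerivWithinAt g c s K := by
  rw [hasDerivWithinAt_iff_isLittleO, Asymptotics.isLittleO_iff]
  intro ε hε
  obtain ⟨η, hη, h⟩ := hup ε hε
  filter_upwards [self_mem_nhdsWithin, mem_nhdsWithin_of_mem_nhds (Metric.closedBall_mem_nhds K hη)]
    with k hk hkη
  have h1 := hlow k hk
  have h2 := h k hk hkη
  simp only [smul_eq_mul, Real.norm_eq_abs]
  rw [abs_of_nonneg (by linarith)]
  linarith

/-! ### Uniform estimates for the dispatch cost -/

namespace PowerSystem

variable {W : PowerSystem} {K k : ℝ} {V Vk : ℝ → ℝ} {R : W.Charge K → ℝ → W.Charge K}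

theorem Regular.continuous_DC (hW : W.Regular) : Continuous W.DC := hW.differentiable_DC.continuous

theorem Regular.continuous_deriv_DC (hW : W.Regular) : Continuous (deriv W.DC) :=
  hW.convex_DC.continuous_deriv hW.differentiable_DC

/-- With closing charges in a given range, the net demand stays in a compact interval. -/
theorem Regular.exists_netDemand_mem (hW : W.Regular) (K S : ℝ) : ∃ a b : ℝ, ∀ᵐ L ∂W.load,
    ∀ s ∈ Icc (W.Smin - |K| - |S|) (W.Smin + |K| + |S|), ∀ σ ∈ Icc W.Smin (W.Smin + K),
      L - (s - σ) / W.Δ ∈ Icc a b := by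
  obtain ⟨l, u, h⟩ := hW.bounded_load
  refine ⟨l - (2 * |K| + |S|) / W.Δ, u + (2 * |K| + |S|) / W.Δ, ?_⟩
  filter_upwards [h] with L hL s hs σ hσ
  have hK := le_abs_self K
  have hK0 := abs_nonneg K
  have h1 : (s - σ) / W.Δ ≤ (2 * |K| + |S|) / W.Δ :=
    div_le_div_of_nonneg_right (by linarith [hs.2, hσ.1]) hW.Δ_pos.le
  have h2 : -((2 * |K| + |S|) / W.Δ) ≤ (s - σ) / W.Δ := by
    rw [← neg_div]
    exact div_le_div_of_nonneg_right (by linarith [hs.1, hσ.2]) hW.Δ_pos.le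
  exact ⟨by linarith [hL.1], by linarith [hL.2]⟩

theorem Regular.exists_abs_comp_netDemand_le (hW : W.Regular) {g : ℝ → ℝ} (hg : Continuous g)
    (K S : ℝ) : ∃ C : ℝ, ∀ᵐ L ∂W.load,
      ∀ s ∈ Icc (W.Smin - |K| - |S|) (W.Smin + |K| + |S|), ∀ σ ∈ Icc W.Smin (W.Smin + K),
        |g (L - (s - σ) / W.Δ)| ≤ C := by
  obtain ⟨a, b, h⟩ := hW.exists_netDemand_mem K S
  obtain ⟨C, hC⟩ := isCompact_Icc.exists_bound_of_continuousOn (s := Icc a b) hg.continuousOn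
  refine ⟨C, ?_⟩
  filter_upwards [h] with L hL s hs σ hσ
  exact hC _ (hL s hs σ hσ)

theorem charge_mem (S : W.Charge K) :
    (S : ℝ) ∈ Icc (W.Smin - |K| - |(0 : ℝ)|) (W.Smin + |K| + |(0 : ℝ)|) := by
  have h1 := le_abs_self K
  have h2 := abs_nonneg K
  rw [abs_zero]
  exact ⟨by linarith [S.2.1], by linarith [S.2.2]⟩

/-- The first-order expansion of the cost of dispatch is uniform. -/
theorem Regular.exists_dispatchCost_le (hW : W.Regular) (K : ℝ) {ε : ℝ} (hε : 0 < ε) :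
    ∃ η > 0, ∀ᵐ L ∂W.load, ∀ S σ : W.Charge K, ∀ S' σ' : ℝ,
      |(σ' - σ) - (S' - S)| ≤ η →
      W.Δ * W.DC (L - (S' - σ') / W.Δ) ≤ W.Δ * W.DC (L - ((S : ℝ) - σ) / W.Δ) +
        deriv W.DC (L - ((S : ℝ) - σ) / W.Δ) * ((σ' - σ) - (S' - S)) +
        ε * |(σ' - σ) - (S' - S)| := by
  have hΔ := hW.Δ_pos
  obtain ⟨a, b, h⟩ := hW.exists_netDemand_mem K 0
  obtain ⟨η, hη, hη'⟩ := hW.convex_DC.exists_le_deriv_mul_add hW.differentiable_DC a b hε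
  -- A shift `d` of the charges moves the net demand by `d / W.Δ`.
  refine ⟨η * W.Δ, by positivity, ?_⟩
  filter_upwards [h] with L hL S σ S' σ' hd
  set d := (σ' - σ) - (S' - S) with hd'
  have h1 := hη' _ (hL S (charge_mem S) σ σ.2) (d / W.Δ) (by
    rwa [abs_div, abs_of_pos hΔ, div_le_iff₀ hΔ])
  have h2 : L - ((S : ℝ) - σ) / W.Δ + d / W.Δ = L - (S' - σ') / W.Δ := by
    rw [hd']; ring
  rw [h2, abs_div, abs_of_pos hΔ] at h1
  have h3 := mul_le_mul_of_nonneg_left h1 hΔ.le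
  refine h3.trans_eq ?_
  field_simp

theorem Regular.le_dispatchCost (hW : W.Regular) (L S σ S' σ' : ℝ) :
    W.Δ * W.DC (L - (S - σ) / W.Δ) +
      deriv W.DC (L - (S - σ) / W.Δ) * ((σ' - σ) - (S' - S)) ≤
        W.Δ * W.DC (L - (S' - σ') / W.Δ) := by
  have hΔ := hW.Δ_pos
  have h1 := mul_le_mul_of_nonneg_left (hW.convex_DC.deriv_mul_add_le hW.differentiable_DC
    (L - (S - σ) / W.Δ) (L - (S' - σ') / W.Δ)) hΔ.le
  refine le_of_eq_of_le ?_ h1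
  field_simp
  ring

theorem Regular.integrable_dispatchCost (hW : W.Regular) {σ : ℝ → ℝ} (hσ : Measurable σ)
    (hmem : ∀ L, σ L ∈ Icc W.Smin (W.Smin + k)) (S : ℝ) :
    Integrable (fun L => W.Δ * W.DC (L - (S - σ L) / W.Δ)) W.load := by
  have := hW.prob
  -- This padding makes the interval around `W.Smin` contain an arbitrary opening charge `S`.
  obtain ⟨C, hC⟩ := hW.exists_abs_comp_netDemand_le hW.continuous_DC k (|W.Smin| + |S|)
  refine Integrable.const_mul (Integrable.of_bound (C := C) ?_ ?_) _
  · exact (hW.continuous_DC.measurable.comp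
      (measurable_id.sub ((measurable_const.sub hσ).div_const _))).aestronglyMeasurable
  · filter_upwards [hC] with L hL
    refine hL S ?_ _ (hmem L)
    have h1 := abs_le.1 (le_refl |S|)
    have h2 := abs_le.1 (le_refl |W.Smin|)
    have h3 := abs_nonneg k
    have h4 := le_abs_self (|W.Smin| + |S|)
    exact ⟨by linarith [h1.1, h2.2], by linarith [h1.2, h2.1]⟩

theorem IsSocialValue.integrable_comp (hW : W.Regular) (hV : W.IsSocialValue k Vk) {σ : ℝ → ℝ}
    (hσ : Measurable σ) (hmem : ∀ L, σ L ∈ Icc W.Smin (W.Smin + k)) :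
    Integrable (fun L => Vk (σ L)) W.load := by
  have := hW.prob
  obtain ⟨C, hC⟩ := hV.bounded
  exact integrable_of_measurable_of_abs_le (hV.measurable.comp hσ) (fun L => hC _ (hmem L))

theorem IsSocialValue.integrable_cost (hW : W.Regular) (hV : W.IsSocialValue k Vk) {σ : ℝ → ℝ}
    (hσ : Measurable σ) (hmem : ∀ L, σ L ∈ Icc W.Smin (W.Smin + k)) (S : ℝ) :
    Integrable (fun L => W.Δ * W.DC (L - (S - σ L) / W.Δ) + W.δ * Vk (σ L)) W.load :=
  (hW.integrable_dispatchCost hσ hmem S).add ((hV.integrable_comp hW hσ hmem).const_mul _)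

theorem IsSocialValue.le_expectedCost (hV : W.IsSocialValue k Vk) {σ : ℝ → ℝ} (hσ : Measurable σ)
    (hmem : ∀ L, σ L ∈ Icc W.Smin (W.Smin + k)) (S : ℝ) : Vk S ≤ W.expectedCost Vk S σ :=
  (hV.bellman S).2 ⟨σ, hσ, hmem, rfl⟩

/-! ### The market of an optimal rule and the first-order condition -/

theorem IsOptimalRule.measurable_apply (hR : W.IsOptimalRule K V R) (S : W.Charge K) :
    Measurable (R S) :=
  hR.measurable.comp measurable_prodMk_left

theorem IsOptimalRule.measurable_coe_apply (hR : W.IsOptimalRule K V R) (S : W.Charge K) :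
    Measurable (fun L => (R S L : ℝ)) :=
  measurable_subtype_coe.comp (hR.measurable_apply S)

theorem IsOptimalRule.regular_market (hW : W.Regular) (hR : W.IsOptimalRule K V R) :
    (W.market K R).Regular where
  prob := hW.prob
  measurable_next := hR.measurable
  measurable_price := hW.continuous_deriv_DC.measurable.comp
    (measurable_snd.sub (((measurable_subtype_coe.comp measurable_fst).sub
      (measurable_subtype_coe.comp hR.measurable)).div_const _))
  price_bound := by
    have := hW.prob
    obtain ⟨C, hC⟩ := hW.exists_abs_comp_netDemand_le hW.continuous_deriv_DC K 0
    have hb : ∀ S, ∀ᵐ L ∂W.load, ‖(W.market K R).price S L‖ ≤ C := fun S => by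
      filter_upwards [hC] with L hL using hL S (charge_mem S) _ (R S L).2
    have hi : ∀ S, Integrable ((W.market K R).price S) W.load := fun S => by
      refine Integrable.of_bound ?_ C (hb S)
      exact (hW.continuous_deriv_DC.measurable.comp (measurable_id.sub
        ((measurable_const.sub (hR.measurable_coe_apply S)).div_const _))).aestronglyMeasurable
    refine ⟨C, fun S => ⟨hi S, ?_⟩⟩
    have h := integral_mono_ae (hi S).abs (integrable_const C) (hb S)
    simp only [integral_const, probReal_univ, one_smul] at h
    exact h
  δ_nonneg := hW.δ_nonneg
  δ_lt_one := hW.δ_lt_one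

/-- The cost of the optimal rule in one interval, with continuation value. -/
noncomputable def ruleCost (W : PowerSystem) (V : ℝ → ℝ) (R : W.Charge K → ℝ → W.Charge K)
    (S : W.Charge K) (L : ℝ) : ℝ :=
  W.Δ * W.DC (L - ((S : ℝ) - (R S L : ℝ)) / W.Δ) + W.δ * V (R S L)

theorem IsOptimalRule.integrable_ruleCost (hW : W.Regular) (hV : W.IsSocialValue K V)
    (hR : W.IsOptimalRule K V R) (S : W.Charge K) : Integrable (W.ruleCost V R S) W.load :=
  hV.integrable_cost hW (hR.measurable_coe_apply S) (fun L => (R S L).2) S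

theorem IsOptimalRule.integrable_expansion (hW : W.Regular) (hV : W.IsSocialValue K V)
    (hR : W.IsOptimalRule K V R) (S : W.Charge K) (c m C : ℝ) :
    Integrable (fun L => W.ruleCost V R S L - (W.market K R).price S L * c
      - m * (max (W.δ * (W.market K R).meanPrice (R S L) - (W.market K R).price S L) 0
        + W.δ * (W.market K R).potential (R S L)) + C) W.load := by
  have hM := hR.regular_market hW
  have := hW.prob
  exact (((hR.integrable_ruleCost hW hV S).sub ((hM.integrable_price S).mul_const c)).sub
    (((hM.integrable_max_spread S).add ((hM.integrable_comp_next hM.measurable_potential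
      hM.exists_abs_potential_le S).const_mul W.δ)).const_mul m)).add (integrable_const C)

/-- Turns pointwise comparisons into comparisons with the tangent: optimality of the rule and the
recursion for `potential` evaluate the integral. Here `c` is a shift of the opening charge, `m` a
change of capacity and `C` an error. -/
theorem IsOptimalRule.integral_expansion (hW : W.Regular) (hV : W.IsSocialValue K V)
    (hR : W.IsOptimalRule K V R) (S : W.Charge K) (c m C : ℝ) :
    ∫ L, (W.ruleCost V R S L - (W.market K R).price S L * c
      - m * (max (W.δ * (W.market K R).meanPrice (R S L) - (W.market K R).price S L) 0
        + W.δ * (W.market K R).potential (R S L)) + C) ∂W.load =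
      V S - (W.market K R).meanPrice S * c - m * (W.market K R).potential S + C := by
  have hM := hR.regular_market hW
  have := hW.prob
  have i1 := hR.integrable_ruleCost hW hV S
  have i2 : Integrable (fun L => (W.market K R).price S L * c) W.load :=
    (hM.integrable_price S).mul_const c
  have i3 : Integrable (fun L =>
      max (W.δ * (W.market K R).meanPrice (R S L) - (W.market K R).price S L) 0) W.load :=
    hM.integrable_max_spread S
  have i4 : Integrable (fun L => W.δ * (W.market K R).potential (R S L)) W.load :=
    (hM.integrable_comp_next hM.measurable_potential hM.exists_abs_potential_le S).const_mul W.δ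
  have i34 := (i3.add i4).const_mul m
  simp only [Pi.add_apply] at i34
  have i12 : Integrable (fun L => W.ruleCost V R S L - (W.market K R).price S L * c) W.load :=
    i1.sub i2
  have i : Integrable (fun L => W.ruleCost V R S L - (W.market K R).price S L * c
      - m * (max (W.δ * (W.market K R).meanPrice (R S L) - (W.market K R).price S L) 0
        + W.δ * (W.market K R).potential (R S L))) W.load := i12.sub i34
  rw [integral_add i (integrable_const C), integral_sub i12 i34, integral_sub i1 i2,
    integral_const_mul, integral_add i3 i4, integral_mul_const, integral_const_mul,
    hM.potential_eq S, hR.optimal S]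
  simp only [integral_const, probReal_univ, one_smul]
  rfl

/-- Uniform upper bound of first order for the planner's value function, in the state of charge. -/
theorem IsOptimalRule.exists_value_le (hW : W.Regular) (hV : W.IsSocialValue K V)
    (hR : W.IsOptimalRule K V R) {ε : ℝ} (hε : 0 < ε) :
    ∃ η > 0, ∀ S : W.Charge K, ∀ S' : ℝ, |S' - S| ≤ η →
      V S' ≤ V S - (W.market K R).meanPrice S * (S' - S) + ε * |S' - S| := by
  obtain ⟨η, hη, h⟩ := hW.exists_dispatchCost_le K hε
  refine ⟨η, hη, fun S S' hS => ?_⟩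
  have hm := hR.measurable_coe_apply S
  -- Starting from `S'`, use the closing charges chosen from `S`; they remain feasible.
  have h1 := hV.le_expectedCost hm (fun L => (R S L).2) S'
  have h2 := integral_mono_ae (hV.integrable_cost hW hm (fun L => (R S L).2) S')
    (hR.integrable_expansion hW hV S (S' - S) 0 (ε * |S' - S|)) (by
      filter_upwards [h] with L hL
      have h3 := hL S (R S L) S' (R S L) (by rwa [sub_self, zero_sub, abs_neg])
      rw [sub_self, zero_sub, abs_neg] at h3
      simp only [ruleCost, market] at h3 ⊢
      linarith)
  rw [hR.integral_expansion hW hV] at h2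
  have h4 := h1.trans h2
  linarith

/-- The first-order condition for the optimal rule. -/
theorem IsOptimalRule.integral_nonneg (hW : W.Regular) (hV : W.IsSocialValue K V)
    (hR : W.IsOptimalRule K V R) (S : W.Charge K) {e : ℝ → ℝ} (he : Measurable e)
    (hmem : ∀ L, ∀ t ∈ Icc (0 : ℝ) 1, (R S L : ℝ) + t * e L ∈ Icc W.Smin (W.Smin + K)) :
    Integrable (fun L => ((W.market K R).price S L -
        W.δ * (W.market K R).meanPrice (R S L)) * e L) W.load ∧
      0 ≤ ∫ L, ((W.market K R).price S L -
        W.δ * (W.market K R).meanPrice (R S L)) * e L ∂W.load := by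
  have hM := hR.regular_market hW
  have := hW.prob
  have hK : 0 ≤ K := by linarith [S.2.1, S.2.2]
  have heK : ∀ L, |e L| ≤ K := fun L => by
    have h1 := hmem L 1 ⟨zero_le_one, le_rfl⟩
    have h2 := (R S L).2
    rw [one_mul] at h1
    exact abs_le.2 ⟨by linarith [h1.1, h2.2], by linarith [h1.2, h2.1]⟩
  have hi : Integrable (fun L => ((W.market K R).price S L -
      W.δ * (W.market K R).meanPrice (R S L)) * e L) W.load := by
    have h1 : Integrable (fun L => (W.market K R).price S L -
      W.δ * (W.market K R).meanPrice (R S L)) W.load := by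
      have := (hM.integrable_spread S).neg
      refine this.congr (Eventually.of_forall fun L => ?_)
      simp only [Pi.neg_apply, neg_sub]
      rfl
    exact h1.mul_bdd (c := K) he.aestronglyMeasurable (Eventually.of_forall heK)
  refine ⟨hi, le_of_forall_pos_le_add fun ε hε => ?_⟩
  -- The expansions of dispatch cost and continuation value each cost at most `ε' * (t * K)`; the `+
  -- 1` covers `K = 0`.
  set ε' := ε / (2 * K + 1) with hε'
  have hε'0 : 0 < ε' := by positivity
  obtain ⟨η₁, hη₁, h₁⟩ := hW.exists_dispatchCost_le K hε'0
  obtain ⟨η₂, hη₂, h₂⟩ := hR.exists_value_le hW hV hε'0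
  -- The step `t` is small enough for both expansions, as `|e L| ≤ K`; at the end one divides by
  -- `t`.
  set t := min 1 (min η₁ η₂ / (K + 1)) with ht
  have ht0 : 0 < t := by positivity
  have ht1 : t ≤ 1 := min_le_left _ _
  have htK : t * K ≤ min η₁ η₂ := by
    have h1 : t * (K + 1) ≤ min η₁ η₂ := by
      rw [← le_div_iff₀ (by linarith)]
      exact min_le_right _ _
    nlinarith
  have hte : ∀ L, |t * e L| ≤ t * K := fun L => by
    rw [abs_mul, abs_of_pos ht0]
    exact mul_le_mul_of_nonneg_left (heK L) ht0.le
  have hm : Measurable (fun L => (R S L : ℝ) + t * e L) :=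
    (hR.measurable_coe_apply S).add (he.const_mul t)
  have hmt := fun L => hmem L t ⟨ht0.le, ht1⟩
  have h3 := hV.le_expectedCost hm hmt S
  have i1 := hR.integrable_ruleCost hW hV S
  have i2 : Integrable (fun L => W.ruleCost V R S L + t * (((W.market K R).price S L -
      W.δ * (W.market K R).meanPrice (R S L)) * e L)) W.load := i1.add (hi.const_mul t)
  have h4 := integral_mono_ae (hV.integrable_cost hW hm hmt S)
    (i2.add (integrable_const (2 * (ε' * (t * K))))) (by
      filter_upwards [h₁] with L hL
      have h5 := hL S (R S L) S (R S L + t * e L) (by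
        rw [add_sub_cancel_left, sub_self, sub_zero]
        exact (hte L).trans (htK.trans (min_le_left _ _)))
      have h6 := h₂ (R S L) (R S L + t * e L) (by
        rw [add_sub_cancel_left]
        exact (hte L).trans (htK.trans (min_le_right _ _)))
      rw [add_sub_cancel_left, sub_self, sub_zero] at h5
      rw [add_sub_cancel_left] at h6
      have h7 := mul_le_mul_of_nonneg_left h6 hW.δ_nonneg
      have h8 := mul_le_mul_of_nonneg_left (hte L) hε'0.le
      have h9 : 0 ≤ ε' * |t * e L| := by positivity
      have h10 := mul_le_of_le_one_left h9 hW.δ_lt_one.le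
      simp only [ruleCost, market, Pi.add_apply] at h5 h7 ⊢
      linarith)
  have h5 : V S = ∫ L, W.ruleCost V R S L ∂W.load := hR.optimal S
  simp only [Pi.add_apply] at h4
  rw [integral_add i2 (integrable_const _), integral_add i1 (hi.const_mul t), integral_const_mul,
    ← h5] at h4
  simp only [integral_const, probReal_univ, one_smul] at h4
  have h6 := h3.trans h4
  set I := ∫ L, ((W.market K R).price S L - W.δ * (W.market K R).meanPrice (R S L)) * e L ∂W.load
  have h7 : 0 ≤ t * (I + 2 * (ε' * K)) := by linarith
  have h8 := nonneg_of_mul_nonneg_right h7 ht0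
  have h9 : ε' * (2 * K + 1) = ε := by rw [hε']; field_simp
  linarith

/-- Under the optimal rule the storage is full if the price is below the discounted expected price
of the next interval, and empty if it is above. -/
theorem IsOptimalRule.ae_full_or_empty (hW : W.Regular) (hV : W.IsSocialValue K V)
    (hR : W.IsOptimalRule K V R) (S : W.Charge K) : ∀ᵐ L ∂W.load,
      ((W.market K R).price S L < W.δ * (W.market K R).meanPrice (R S L) →
        (R S L : ℝ) = W.Smin + K) ∧
      (W.δ * (W.market K R).meanPrice (R S L) < (W.market K R).price S L →
        (R S L : ℝ) = W.Smin) := by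
  classical
  have hM := hR.regular_market hW
  have hRm := hR.measurable_coe_apply S
  have hp : Measurable ((W.market K R).price S) := hM.measurable_price_apply S
  have hq : Measurable (fun L => W.δ * (W.market K R).meanPrice (R S L)) :=
    (hM.measurable_meanPrice.comp (hR.measurable_apply S)).const_mul _
  -- Perturb towards full where the price is low, and below towards empty where it is high. Each
  -- integrand is nonpositive with nonnegative integral, so it vanishes almost everywhere.
  obtain ⟨i1, h1⟩ := hR.integral_nonneg hW hV S
    (e := fun L => if (W.market K R).price S L < W.δ * (W.market K R).meanPrice (R S L) then
      W.Smin + K - R S L else 0)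
    (Measurable.ite (measurableSet_lt hp hq) (measurable_const.sub hRm) measurable_const)
    (fun L t ht => by
      have h := (R S L).2
      split_ifs
      · exact ⟨by nlinarith [ht.1, ht.2, h.1, h.2], by nlinarith [ht.1, ht.2, h.1, h.2]⟩
      · simp)
  obtain ⟨i2, h2⟩ := hR.integral_nonneg hW hV S
    (e := fun L => if W.δ * (W.market K R).meanPrice (R S L) < (W.market K R).price S L then
      W.Smin - R S L else 0)
    (Measurable.ite (measurableSet_lt hq hp) (measurable_const.sub hRm) measurable_const)
    (fun L t ht => by
      have h := (R S L).2
      split_ifs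
      · exact ⟨by nlinarith [ht.1, ht.2, h.1, h.2], by nlinarith [ht.1, ht.2, h.1, h.2]⟩
      · simp)
  have z1 := ae_eq_zero_of_nonpos_of_integral_nonneg i1 (fun L => by
    have h := (R S L).2
    split_ifs with hlt
    · exact mul_nonpos_of_nonpos_of_nonneg (by linarith) (by linarith [h.2])
    · simp) h1
  have z2 := ae_eq_zero_of_nonpos_of_integral_nonneg i2 (fun L => by
    have h := (R S L).2
    split_ifs with hlt
    · exact mul_nonpos_of_nonneg_of_nonpos (by linarith) (by linarith [h.1])
    · simp) h2
  filter_upwards [z1, z2] with L hL1 hL2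
  refine ⟨fun h => ?_, fun h => ?_⟩
  · rw [if_pos h] at hL1
    rcases mul_eq_zero.1 hL1 with h' | h' <;> linarith
  · rw [if_pos h] at hL2
    rcases mul_eq_zero.1 hL2 with h' | h' <;> linarith

/-! ### The tangent of the planner's value function -/

/-- The tangent, in the state of charge and the capacity, of the planner's value function. -/
noncomputable def tangent (W : PowerSystem) (V : ℝ → ℝ) (R : W.Charge K → ℝ → W.Charge K)
    (S : W.Charge K) (k S' : ℝ) : ℝ :=
  V S - (W.market K R).meanPrice S * (S' - S) - (k - K) * (W.market K R).potential S

/-- Provides the finite suprema on which both contraction arguments start. -/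
theorem IsOptimalRule.exists_abs_value_sub_tangent_le (hW : W.Regular) (hV : W.IsSocialValue K V)
    (hR : W.IsOptimalRule K V R) (hVk : W.IsSocialValue k Vk) :
    ∃ C : ℝ, ∀ S : W.Charge K, ∀ S' ∈ Icc W.Smin (W.Smin + k), |Vk S' - W.tangent V R S k S'| ≤ C := by
  have hM := hR.regular_market hW
  obtain ⟨C₁, h₁⟩ := hV.bounded
  obtain ⟨C₂, h₂⟩ := hVk.bounded
  obtain ⟨C₃, h₃⟩ := hM.exists_abs_meanPrice_le
  obtain ⟨C₄, h₄⟩ := hM.exists_abs_potential_le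
  refine ⟨C₂ + (C₁ + C₃ * (|k| + |K|) + |k - K| * C₄), fun S S' hS' => ?_⟩
  refine (abs_sub _ _).trans (add_le_add (h₂ S' hS') ?_)
  refine (abs_sub _ _).trans (add_le_add ((abs_sub _ _).trans (add_le_add (h₁ S S.2) ?_)) ?_)
  · rw [abs_mul]
    have := le_abs_self k
    have := le_abs_self K
    have := abs_nonneg k
    have := abs_nonneg K
    exact mul_le_mul (h₃ S) (abs_le.2 ⟨by linarith [hS'.1, S.2.2], by linarith [hS'.2, S.2.1]⟩)
      (abs_nonneg _) ((abs_nonneg _).trans (h₃ S))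
  · rw [abs_mul]
    exact mul_le_mul_of_nonneg_left (h₄ S) (abs_nonneg _)

/-- Compare an optimal strategy `σ` for capacity `k` with the rule `R`. Convexity bounds the
dispatch cost below. Where `R` is full, `σ` exceeds it by at most `k - K`; where `R` is empty, `σ`
is not below it; at ties the slope vanishes. So deviating gains at most `k - K` times the positive
part of the spread. -/
theorem IsOptimalRule.tangent_sub_le (hW : W.Regular) (hV : W.IsSocialValue K V)
    (hR : W.IsOptimalRule K V R) (hVk : W.IsSocialValue k Vk) {B : ℝ}
    (hB : ∀ S : W.Charge K, ∀ S' ∈ Icc W.Smin (W.Smin + k), W.tangent V R S k S' - Vk S' ≤ B)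
    (S : W.Charge K) (S' : ℝ) : W.tangent V R S k S' - Vk S' ≤ W.δ * B := by
  obtain ⟨σ, hσ, hmem, h⟩ := (hVk.bellman S').1
  have h1 := integral_mono_ae (hR.integrable_expansion hW hV S (S' - S) (k - K) (-(W.δ * B)))
    (hVk.integrable_cost hW hσ hmem S') (by
      filter_upwards [hR.ae_full_or_empty hW hV S] with L hL
      have h2 := hW.le_dispatchCost L S (R S L) S' (σ L)
      have h3 := mul_le_mul_of_nonneg_left (hB (R S L) (σ L) (hmem L)) hW.δ_nonneg
      have h4 : -((k - K) * max (W.δ * (W.market K R).meanPrice (R S L) -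
          (W.market K R).price S L) 0) ≤ ((W.market K R).price S L -
            W.δ * (W.market K R).meanPrice (R S L)) * (σ L - R S L) := by
        have hσL := hmem L
        rcases lt_trichotomy ((W.market K R).price S L)
          (W.δ * (W.market K R).meanPrice (R S L)) with hlt | heq | hgt
        · rw [max_eq_left (by linarith), hL.1 hlt]
          nlinarith [hσL.2]
        · simp [heq]
        · rw [max_eq_right (by linarith), hL.2 hgt, mul_zero, neg_zero]
          exact mul_nonneg (by linarith) (by linarith [hσL.1])
      have h5 : (W.market K R).price S L = deriv W.DC (L - ((S : ℝ) - R S L) / W.Δ) := rfl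
      rw [← h5] at h2
      simp only [tangent, ruleCost] at h3 ⊢
      linarith)
  rw [hR.integral_expansion hW hV] at h1
  have h2 : Vk S' = ∫ L, (W.Δ * W.DC (L - (S' - σ L) / W.Δ) + W.δ * Vk (σ L)) ∂W.load := h
  rw [← h2] at h1
  simp only [tangent]
  linarith

/-- The planner's value function lies above its tangent. -/
theorem IsOptimalRule.tangent_le (hW : W.Regular) (hV : W.IsSocialValue K V)
    (hR : W.IsOptimalRule K V R) (hVk : W.IsSocialValue k Vk) (S : W.Charge K) (S' : ℝ) :
    W.tangent V R S k S' ≤ Vk S' := by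
  obtain ⟨C, hC⟩ := hR.exists_abs_value_sub_tangent_le hW hV hVk
  have key := le_div_one_sub_of_forall_upperBound (c := 0) (δ := W.δ)
    (A := {r | ∃ S : W.Charge K, ∃ S' ∈ Icc W.Smin (W.Smin + k), r = W.tangent V R S k S' - Vk S'})
    ?_ hW.δ_lt_one ?_
  · rw [zero_div] at key
    -- One more step with `B = 0` extends the bound to every real `S'`.
    have := hR.tangent_sub_le hW hV hVk (fun S S' hS' => key _ ⟨S, S', hS', rfl⟩) S S'
    linarith
  · refine ⟨C, ?_⟩
    rintro r ⟨S, S', hS', rfl⟩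
    linarith [(abs_le.1 (hC S S' hS')).1]
  · rintro B hB r ⟨S, S', hS', rfl⟩
    rw [zero_add]
    exact hR.tangent_sub_le hW hV hVk (fun S S' hS' => hB _ ⟨S, S', hS', rfl⟩) S S'

/-- Shadowing the rule keeps the two charges within `|k - K|` of each other, so the hypothesis on
`B` applies again to the closing charges. -/
theorem IsOptimalRule.exists_sub_tangent_le (hW : W.Regular) (hV : W.IsSocialValue K V)
    (hR : W.IsOptimalRule K V R) {ε : ℝ} (hε : 0 < ε) :
    ∃ η > 0, ∀ (k : ℝ) (Vk : ℝ → ℝ), 0 ≤ k → |k - K| ≤ η → W.IsSocialValue k Vk →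
      ∀ B : ℝ, (∀ S : W.Charge K, ∀ S' ∈ Icc W.Smin (W.Smin + k), |S' - S| ≤ |k - K| →
          Vk S' - W.tangent V R S k S' ≤ B) →
        ∀ (S : W.Charge K) (S' : ℝ), |S' - S| ≤ |k - K| →
          Vk S' - W.tangent V R S k S' ≤ ε * |k - K| + W.δ * B := by
  classical
  have hM := hR.regular_market hW
  obtain ⟨η, hη, h⟩ := hW.exists_dispatchCost_le K (half_pos hε)
  refine ⟨η / 2, half_pos hη, fun k Vk hk hkη hVk B hB S S' hS' => ?_⟩
  have hRm := hR.measurable_coe_apply S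
  have hp : Measurable ((W.market K R).price S) := hM.measurable_price_apply S
  have hq : Measurable (fun L => W.δ * (W.market K R).meanPrice (R S L)) :=
    (hM.measurable_meanPrice.comp (hR.measurable_apply S)).const_mul _
  -- Full at the new capacity when the price is low; otherwise the rule, truncated in case `k < K`.
  -- Truncation matters to first order only at ties, where the slope is zero.
  set σ : ℝ → ℝ := fun L =>
    if (W.market K R).price S L < W.δ * (W.market K R).meanPrice (R S L) then W.Smin + k
    else min (R S L : ℝ) (W.Smin + k) with hσ
  have hσm : Measurable σ :=
    Measurable.ite (measurableSet_lt hp hq) measurable_const (hRm.min measurable_const)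
  have hmem : ∀ L, σ L ∈ Icc W.Smin (W.Smin + k) := fun L => by
    simp only [hσ]
    split_ifs
    · exact ⟨by linarith, le_rfl⟩
    · exact ⟨le_min (R S L).2.1 (by linarith), min_le_right _ _⟩
  have h1 := hVk.le_expectedCost hσm hmem S'
  have h2 := integral_mono_ae (hVk.integrable_cost hW hσm hmem S')
    (hR.integrable_expansion hW hV S (S' - S) (k - K) (ε * |k - K| + W.δ * B)) (by
      filter_upwards [h, hR.ae_full_or_empty hW hV S] with L hL hL'
      have h3 : |σ L - R S L| ≤ |k - K| ∧
          ((W.market K R).price S L - W.δ * (W.market K R).meanPrice (R S L)) * (σ L - R S L) =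
            -((k - K) * max (W.δ * (W.market K R).meanPrice (R S L) -
              (W.market K R).price S L) 0) := by
        by_cases hlt : (W.market K R).price S L < W.δ * (W.market K R).meanPrice (R S L)
        · have h4 : σ L = W.Smin + k := if_pos hlt
          rw [max_eq_left (by linarith), h4, hL'.1 hlt]
          refine ⟨by rw [add_sub_add_left_eq_sub], by ring⟩
        · have h4 : σ L = min (R S L : ℝ) (W.Smin + k) := if_neg hlt
          rw [max_eq_right (by linarith), h4]
          constructor
          · have h5 := (R S L).2.2
            have h6 := neg_abs_le (k - K)
            have h7 := abs_nonneg (k - K)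
            rcases min_cases (R S L : ℝ) (W.Smin + k) with ⟨h8, _⟩ | ⟨h8, _⟩ <;> rw [h8]
            · simp
            · exact abs_le.2 ⟨by linarith, by linarith⟩
          · rcases eq_or_lt_of_le (not_lt.1 hlt) with heq | hgt
            · simp [heq]
            · rw [hL'.2 hgt, min_eq_left (by linarith)]
              simp
      -- Opening and closing charges each differ by at most `|k - K|`, hence the expansion with `ε /
      -- 2`.
      have hd : |(σ L - R S L) - (S' - S)| ≤ 2 * |k - K| :=
        (abs_sub _ _).trans (by linarith [h3.1])
      have h4 := hL S (R S L) S' (σ L) (by linarith)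
      have h5 := mul_le_mul_of_nonneg_left (hB (R S L) (σ L) (hmem L) h3.1) hW.δ_nonneg
      have h6 := mul_le_mul_of_nonneg_left hd (half_pos hε).le
      have h7 : (W.market K R).price S L = deriv W.DC (L - ((S : ℝ) - R S L) / W.Δ) := rfl
      rw [← h7] at h4
      simp only [tangent, ruleCost] at h5 ⊢
      linarith [h3.2])
  rw [hR.integral_expansion hW hV] at h2
  have h3 := h1.trans h2
  simp only [tangent]
  linarith

/-- The planner's value function exceeds its tangent by little, uniformly in the state. -/
theorem IsOptimalRule.exists_value_le_tangent_add (hW : W.Regular) (hV : W.IsSocialValue K V)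
    (hR : W.IsOptimalRule K V R) {ε : ℝ} (hε : 0 < ε) :
    ∃ η > 0, ∀ (k : ℝ) (Vk : ℝ → ℝ), 0 ≤ k → |k - K| ≤ η → W.IsSocialValue k Vk →
      ∀ S : W.Charge K, Vk S ≤ W.tangent V R S k S + ε * |k - K| := by
  have hδ : 0 < 1 - W.δ := sub_pos.2 hW.δ_lt_one
  obtain ⟨η, hη, h⟩ := hR.exists_sub_tangent_le hW hV (mul_pos hε hδ)
  refine ⟨η, hη, fun k Vk hk hkη hVk S => ?_⟩
  obtain ⟨C, hC⟩ := hR.exists_abs_value_sub_tangent_le hW hV hVk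
  have key := le_div_one_sub_of_forall_upperBound (c := ε * (1 - W.δ) * |k - K|) (δ := W.δ)
    (A := {r | ∃ S : W.Charge K, ∃ S' ∈ Icc W.Smin (W.Smin + k), |S' - S| ≤ |k - K| ∧
      r = Vk S' - W.tangent V R S k S'}) ?_ hW.δ_lt_one ?_
  · have h1 := h k Vk hk hkη hVk _ (fun S S' hS' hd => key _ ⟨S, S', hS', hd, rfl⟩) S S (by simp)
    have h2 : ε * (1 - W.δ) * |k - K| / (1 - W.δ) = ε * |k - K| := by field_simp
    rw [h2] at h1
    linarith
  · refine ⟨C, ?_⟩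
    rintro r ⟨S, S', hS', -, rfl⟩
    exact (abs_le.1 (hC S S' hS')).2
  · rintro B hB r ⟨S, S', hS', hd, rfl⟩
    exact h k Vk hk hkη hVk B (fun S S' hS' hd => hB _ ⟨S, S', hS', hd, rfl⟩) S S' hd

end PowerSystem

/-! ### Averages over the stationary law and social incentives -/

namespace PowerSystem

variable {W : PowerSystem} {K k f : ℝ} {V : ℝ → ℝ → ℝ} {Vk : ℝ → ℝ}
  {R : W.Charge K → ℝ → W.Charge K} {x : Measure (W.Charge K)}

/-- Boundedness is given only on the range for `k`, which may be smaller than the range for `K`;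
always closing empty bounds the cost above. The bound below comes from `tangent_le`. -/
theorem IsSocialValue.exists_le (hW : W.Regular) (hVk : W.IsSocialValue k Vk) (hk : 0 ≤ k)
    (K : ℝ) : ∃ C : ℝ, ∀ S : W.Charge K, Vk S ≤ C := by
  have := hW.prob
  obtain ⟨C, hC⟩ := hW.exists_abs_comp_netDemand_le hW.continuous_DC K 0
  refine ⟨W.Δ * C + W.δ * Vk W.Smin, fun S => ?_⟩
  have hK : 0 ≤ K := by linarith [S.2.1, S.2.2]
  have hmem : ∀ _ : ℝ, W.Smin ∈ Icc W.Smin (W.Smin + k) := fun _ => ⟨le_rfl, by linarith⟩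
  have h1 := hVk.le_expectedCost (σ := fun _ => W.Smin) measurable_const hmem S
  have h2 := integral_mono_ae (hVk.integrable_cost hW (σ := fun _ => W.Smin) measurable_const hmem S)
    (integrable_const (W.Δ * C + W.δ * Vk W.Smin)) (by
      filter_upwards [hC] with L hL
      have h3 := (abs_le.1 (hL S (charge_mem S) W.Smin ⟨le_rfl, by linarith⟩)).2
      have h4 := mul_le_mul_of_nonneg_left h3 hW.Δ_pos.le
      linarith)
  have h3 := h1.trans h2
  simpa using h3

theorem IsOptimalRule.integrable_value (hW : W.Regular) {VK : ℝ → ℝ} (hV : W.IsSocialValue K VK)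
    (hR : W.IsOptimalRule K VK R) (hx : (W.market K R).IsStationary x)
    (hVk : W.IsSocialValue k Vk) (hk : 0 ≤ k) :
    Integrable (fun S : W.Charge K => Vk S) x := by
  have := hx.prob
  obtain ⟨C, hC⟩ := hVk.exists_le hW hk K
  obtain ⟨C₁, h₁⟩ := hV.bounded
  obtain ⟨C₂, h₂⟩ := (hR.regular_market hW).exists_abs_potential_le
  refine integrable_of_measurable_of_abs_le (C := max C (C₁ + |k - K| * C₂))
    (hVk.measurable.comp measurable_subtype_coe) (fun S => abs_le.2 ⟨?_, (hC S).trans (le_max_left _ _)⟩)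
  have h3 := hR.tangent_le hW hV hVk S S
  have h4 := (abs_le.1 (h₁ S S.2)).1
  have h5 : (k - K) * (W.market K R).potential S ≤ |k - K| * C₂ := by
    refine (le_abs_self _).trans ?_
    rw [abs_mul]
    exact mul_le_mul_of_nonneg_left (h₂ S) (abs_nonneg _)
  have h6 := le_max_right C (C₁ + |k - K| * C₂)
  simp only [tangent, sub_self, mul_zero, sub_zero] at h3
  linarith

theorem IsOptimalRule.hasDerivWithinAt_value (hW : W.Regular)
    (hV : ∀ k : ℝ, 0 ≤ k → W.IsSocialValue k (V k)) (hK : 0 ≤ K) (hR : W.IsOptimalRule K (V K) R)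
    (S : W.Charge K) :
    HasDerivWithinAt (fun k => V k S) (-(W.market K R).potential S) (Ici 0) K := by
  refine hasDerivWithinAt_of_le_of_le (fun k hk => ?_) (fun ε hε => ?_)
  · have h := hR.tangent_le hW (hV K hK) (hV k hk) S S
    simp only [tangent, sub_self, mul_zero, sub_zero] at h
    linarith
  · obtain ⟨η, hη, h⟩ := hR.exists_value_le_tangent_add hW (hV K hK) hε
    refine ⟨η, hη, fun k hk hkη => ?_⟩
    have h1 := h k (V k) hk hkη (hV k hk) S
    simp only [tangent, sub_self, mul_zero, sub_zero] at h1
    linarith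

theorem IsOptimalRule.integral_tangent (hW : W.Regular) {VK : ℝ → ℝ} (hV : W.IsSocialValue K VK)
    (hR : W.IsOptimalRule K VK R) (hx : (W.market K R).IsStationary x) (hK : 0 ≤ K) (k C : ℝ) :
    Integrable (fun S : W.Charge K => W.tangent VK R S k S + C) x ∧
    ∫ S : W.Charge K, (W.tangent VK R S k S + C) ∂x =
      (∫ S : W.Charge K, VK S ∂x) - (k - K) * ((W.market K R).averageArea x / (1 - W.δ)) + C := by
  have hM := hR.regular_market hW
  have := hx.prob
  have i1 := hR.integrable_value hW hV hx hV hK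
  have i2 := (hM.integrable_potential hx).const_mul (k - K)
  have i3 : Integrable (fun S : W.Charge K => W.tangent VK R S k S) x := by
    simp only [tangent, sub_self, mul_zero, sub_zero]
    exact i1.sub i2
  refine ⟨i3.add (integrable_const C), ?_⟩
  rw [integral_add i3 (integrable_const C)]
  simp only [tangent, sub_self, mul_zero, sub_zero]
  rw [integral_sub i1 i2, integral_const_mul, hM.integral_potential hx]
  simp only [integral_const, probReal_univ, one_smul]
  rfl

/-- A global supporting line, from averaging `tangent_le`: it yields sufficiency for the minimum and
shows that a cost reduction at a single larger capacity already forces the area above `f`. -/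
theorem IsOptimalRule.totalCost_add_le (hW : W.Regular)
    (hV : ∀ k : ℝ, 0 ≤ k → W.IsSocialValue k (V k)) (hK : 0 ≤ K) (hR : W.IsOptimalRule K (V K) R)
    (hx : (W.market K R).IsStationary x) (hk : 0 ≤ k) :
    W.totalCost x f V K + (k - K) * -(((W.market K R).averageArea x - f) / (1 - W.δ)) ≤
      W.totalCost x f V k := by
  obtain ⟨i, h⟩ := hR.integral_tangent hW (hV K hK) hx hK k 0
  have h1 := integral_mono i (hR.integrable_value hW (hV K hK) hx (hV k hk) hk) (fun S => by
    have := hR.tangent_le hW (hV K hK) (hV k hk) S S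
    dsimp only
    linarith)
  rw [h] at h1
  simp only [totalCost]
  rw [sub_div]
  linarith

/-- The upper estimate is uniform in the state, so the squeeze survives integration. -/
theorem IsOptimalRule.hasDerivWithinAt_totalCost (hW : W.Regular)
    (hV : ∀ k : ℝ, 0 ≤ k → W.IsSocialValue k (V k)) (hK : 0 ≤ K) (hR : W.IsOptimalRule K (V K) R)
    (hx : (W.market K R).IsStationary x) :
    HasDerivWithinAt (fun k => W.totalCost x f V k)
      (-(((W.market K R).averageArea x - f) / (1 - W.δ))) (Ici 0) K := by
  refine hasDerivWithinAt_of_le_of_le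
    (fun k hk => hR.totalCost_add_le hW hV hK hx hk) (fun ε hε => ?_)
  obtain ⟨η, hη, h⟩ := hR.exists_value_le_tangent_add hW (hV K hK) hε
  refine ⟨η, hη, fun k hk hkη => ?_⟩
  obtain ⟨i, hi⟩ := hR.integral_tangent hW (hV K hK) hx hK k (ε * |k - K|)
  have h1 := integral_mono (hR.integrable_value hW (hV K hK) hx (hV k hk) hk) i
    (fun S => h k (V k) hk hkη (hV k hk) S)
  rw [hi] at h1
  simp only [totalCost]
  rw [sub_div]
  linarith

theorem IsOptimalRule.isMinOn_totalCost_iff (hW : W.Regular)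
    (hV : ∀ k : ℝ, 0 ≤ k → W.IsSocialValue k (V k)) (hK : 0 < K) (hR : W.IsOptimalRule K (V K) R)
    (hx : (W.market K R).IsStationary x) :
    IsMinOn (fun k => W.totalCost x f V k) (Ici 0) K ↔ (W.market K R).averageArea x = f := by
  have hδ : 0 < 1 - W.δ := sub_pos.2 hW.δ_lt_one
  constructor
  · intro h
    have h1 := (h.isLocalMin (Ici_mem_nhds hK)).hasDerivAt_eq_zero
      ((hR.hasDerivWithinAt_totalCost (f := f) hW hV hK.le hx).hasDerivAt (Ici_mem_nhds hK))
    rw [neg_eq_zero, div_eq_zero_iff] at h1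
    rcases h1 with h1 | h1 <;> linarith
  · intro h k hk
    have h1 := hR.totalCost_add_le (f := f) hW hV hK.le hx hk
    rw [h] at h1
    simpa using h1

theorem IsOptimalRule.beneficialToAdd_iff (hW : W.Regular)
    (hV : ∀ k : ℝ, 0 ≤ k → W.IsSocialValue k (V k)) (hK : 0 ≤ K) (hR : W.IsOptimalRule K (V K) R)
    (hx : (W.market K R).IsStationary x) :
    W.BeneficialToAdd x f V ↔ f < (W.market K R).averageArea x := by
  have hδ : 0 < 1 - W.δ := sub_pos.2 hW.δ_lt_one
  constructor
  · intro h
    obtain ⟨t, ht, ht0⟩ := (h.and self_mem_nhdsWithin).exists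
    have ht0 : (0 : ℝ) < t := ht0
    have h1 := hR.totalCost_add_le (f := f) (k := K + t) hW hV hK hx (by linarith)
    rw [add_sub_cancel_left] at h1
    have h2 : 0 < t * (((W.market K R).averageArea x - f) / (1 - W.δ)) := by linarith
    have h3 := (div_pos_iff_of_pos_right hδ).1 (pos_of_mul_pos_right h2 ht0.le)
    linarith
  · intro h
    have h1 := (hR.hasDerivWithinAt_totalCost (f := f) hW hV hK hx).neg
    rw [neg_neg] at h1
    filter_upwards [h1.eventually_lt_add hK (div_pos (by linarith) hδ)] with t ht
    exact neg_lt_neg_iff.1 ht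

end PowerSystem

/-! ### Private and social incentives combined -/

theorem theoremB :
    -- Private incentives, in any market with a Markov state
    (∀ (𝓢 : Type*) (𝓛 : Type*) [MeasurableSpace 𝓢] [MeasurableSpace 𝓛] (M : Market 𝓢 𝓛)
      (x : Measure 𝓢) (smin f : ℝ), M.Regular → M.IsStationary x →
      (∀ K : ℝ, 0 ≤ K → ∃! V : ℝ → 𝓢 → ℝ, M.IsPrivateValue smin K V) ∧
      ∀ V : ℝ → ℝ → 𝓢 → ℝ, (∀ K : ℝ, 0 ≤ K → M.IsPrivateValue smin K (V K)) →
        ∀ (K : ℝ) (s : ℝ), 0 ≤ K →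
          (∃ v : 𝓢 → ℝ, (∀ S, HasDerivWithinAt (fun k => V k s S) (v S) (Ici 0) K) ∧
            Integrable v x ∧ ∫ S, v S ∂x = M.averageArea x / (1 - M.δ)) ∧
          HasDerivWithinAt (fun k => M.netPresentValue x f V s k)
            ((M.averageArea x - f) / (1 - M.δ)) (Ici 0) K ∧
          (M.ProfitableToAugment x f V s K ↔ f < M.averageArea x)) ∧
    -- Agreement with the social incentives, when the system storage is operated optimally
    (∀ (W : PowerSystem) (f : ℝ) (K : ℝ) (V : ℝ → ℝ → ℝ)
      (R : W.Charge K → ℝ → W.Charge K) (x : Measure (W.Charge K)),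
      W.Regular → 0 ≤ K → (∀ k : ℝ, 0 ≤ k → W.IsSocialValue k (V k)) →
      W.IsOptimalRule K (V K) R → (W.market K R).IsStationary x →
        (∃ v : W.Charge K → ℝ,
          (∀ S : W.Charge K, HasDerivWithinAt (fun k => V k S) (v S) (Ici 0) K) ∧
          Integrable v x ∧ ∫ S, v S ∂x = -(W.market K R).averageArea x / (1 - W.δ)) ∧
        HasDerivWithinAt (fun k => W.totalCost x f V k)
          (-(((W.market K R).averageArea x - f) / (1 - W.δ))) (Ici 0) K ∧
        (0 < K → (IsMinOn (fun k => W.totalCost x f V k) (Ici 0) K ↔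
          (W.market K R).averageArea x = f)) ∧
        ∀ (smin : ℝ) (U : ℝ → ℝ → W.Charge K → ℝ),
          (∀ k : ℝ, 0 ≤ k → (W.market K R).IsPrivateValue smin k (U k)) →
          ∀ (κ : ℝ) (s : ℝ), 0 ≤ κ →
            ((W.market K R).ProfitableToAugment x f U s κ ↔ W.BeneficialToAdd x f V)) := by
  refine ⟨fun 𝓢 𝓛 _ _ M x smin f hM hx =>
    ⟨fun K hK => ⟨M.privateValue smin K, hM.isPrivateValue_privateValue hK,
      fun V hV => hV.eq_privateValue hM hK⟩,
    fun V hV K s hK => ⟨hM.exists_hasDerivWithinAt_privateValue hx hV s hK,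
      hM.hasDerivWithinAt_netPresentValue hx hV s hK, hM.profitableToAugment_iff hx hV s hK⟩⟩, ?_⟩
  intro W f K V R x hW hK hV hR hx
  have hM := hR.regular_market hW
  refine ⟨⟨fun S => -(W.market K R).potential S, hR.hasDerivWithinAt_value hW hV hK,
    (hM.integrable_potential hx).neg, ?_⟩, hR.hasDerivWithinAt_totalCost hW hV hK hx,
    fun hK' => hR.isMinOn_totalCost_iff hW hV hK' hx, fun smin U hU κ s hκ => ?_⟩
  · rw [integral_neg, hM.integral_potential hx, neg_div]
    rfl
  · rw [hM.profitableToAugment_iff hx hU s hκ, hR.beneficialToAdd_iff hW hV hK hx]
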